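/- Let $K=GF(4)$, let $\zeta$ be a primitive element of $K$ (a generator of $K^\times$), and let $\Omega=\mathbb{P}^2(K)$ be the set of the 21 points $[x,y,z]$ of the projective plane over $K$. Let $u,v,w$ be three further points. The group $PSL_3(4)$ acts on the 24 points of $\Omega\cup\{u,v,w\}$ by its natural action (matrices acting on column vectors) on $\Omega$, fixing $u$, $v$ and $w$. The Mathieu group $M_{24}$ is the permutation group on these 24 points obtained by Witt's construction as $$M_{22}=\langle PSL_3(4),S_3\rangle,\qquad M_{23}=\langle M_{22},S_4\rangle,\qquad M_{24}=\langle M_{23},S_5\rangle,$$ where * $S_3$ interchanges $u$ and $[1,0,0]$, fixes $v,w$, and $S_3[x,y,z]=[x^2+yz,\,y^2,\,z^2]$ for $[x,y,z]\neq[1,0,0]$; * $S_4$ interchanges $u$ and $v$, fixes $w$, and $S_4[x,y,z]=[x^2,y^2,\zeta z^2]$; * $S_5$ interchanges $v$ and $w$, fixes $u$, and $S_5[x,y,z]=[x^2,y^2,z^2]$. Let $\mathfrak{s},\mathfrak{j},\mathfrak{t},\mathfrak{r}$ be the permutations induced, respectively, by the matrices $$\begin{pmatrix}1&1&0\\0&1&0\\0&0&1\end{pmatrix},\quad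 \begin{pmatrix}0&1&0\\1&0&0\\0&0&1\end{pmatrix},\quad \begin{pmatrix}0&0&1\\0&1&0\\1&0&0\end{pmatrix},\quad \begin{pmatrix}\zeta&0&0\\0&1&0\\0&0&\zeta^{-1}\end{pmatrix}$$ of $SL_3(4)$, and put $\mathfrak{u}=S_3$, $\mathfrak{v}=S_4$, $\mathfrak{w}=S_5$. Write $x^y=y^{-1}xy$. **Proposition.** The group $M_{24}$ is generated by $\mathfrak{s},\mathfrak{j},\mathfrak{t},\mathfrak{r},\mathfrak{u},\mathfrak{v},\mathfrak{w}$, and the following are defining relations for $M_{24}$ with respect to these generators (that is, the abstract group presented by seven symbols and these relations is isomorphic to $M_{24}$ via the map sending each symbol to the permutation of the same name): $$\mathfrak{s}^2=\mathfrak{j}^2=\mathfrak{t}^2=\mathfrak{r}^3=(\mathfrak{j}\mathfrak{r})^2=(\mathfrak{t}\mathfrak{r})^2=(\mathfrak{s}\mathfrak{r})^3=(\mathfrak{j}\mathfrak{s})^3=(\mathfrak{t}\mathfrak{j})^3=(\mathfrak{t}\mathfrak{s}\mathfrak{t}\mathfrak{j}\mathfrak{s})^3=1,$$ $$\mathfrak{t}\mathfrak{s}\mathfrak{t}\cdot\mathfrak{j}\mathfrak{r}\cdot\mathfrak{t}\mathfrak{s}\mathfrak{t}=\mathfrak{r}\mathfrak{s}\mathfrak{r}^{-1}\mathfrak{j}\mathfrak{r}\cdot\mathfrak{t}\mathfrak{s}\mathfrak{t}\cdot\mathfrak{r}\mathfrak{s}\mathfrak{r}^{-1}\mathfrak{j}\mathfrak{r}^{-1}\mathfrak{s}\mathfrak{r}^{-1};$$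 $$\mathfrak{u}^2=(\mathfrak{u}\mathfrak{s})^2=(\mathfrak{u}\mathfrak{j})^3=1,\quad \mathfrak{r}^{\mathfrak{u}}=\mathfrak{r}^{\mathfrak{j}},\quad \mathfrak{s}^{\mathfrak{t}\mathfrak{u}}=\mathfrak{s}\,\mathfrak{s}^{\mathfrak{t}},\quad \mathfrak{s}^{\mathfrak{j}\mathfrak{t}\mathfrak{u}}=\mathfrak{s}^{\mathfrak{j}\mathfrak{t}}\,\mathfrak{s}^{\mathfrak{t}\mathfrak{j}\mathfrak{t}};$$ $$\mathfrak{v}^2=(\mathfrak{v}\mathfrak{s})^2=(\mathfrak{v}\mathfrak{u})^3=(\mathfrak{v}\mathfrak{j})^2=(\mathfrak{v}\mathfrak{r})^2=1,\quad \mathfrak{s}^{\mathfrak{t}\mathfrak{v}}=\mathfrak{s}^{\mathfrak{t}\mathfrak{r}},\quad \mathfrak{s}^{\mathfrak{j}\mathfrak{t}\mathfrak{v}}=\mathfrak{s}^{\mathfrak{j}\mathfrak{t}\mathfrak{r}};$$ $$\mathfrak{w}^2=(\mathfrak{w}\mathfrak{r})^2=(\mathfrak{w}\mathfrak{s})^2=(\mathfrak{w}\mathfrak{j})^2=(\mathfrak{w}\mathfrak{u})^2=(\mathfrak{w}\mathfrak{s}^{\mathfrak{t}})^2=(\mathfrak{w}\mathfrak{s}^{\mathfrak{j}\mathfrak{t}})^2=(\mathfrak{w}\mathfrak{v})^3=1.$$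 -/

import Mathlib

open scoped LinearAlgebra.Projectivization

noncomputable section

namespace Mathieu

/-- The field `GF(4)`. -/
abbrev F4 : Type := GaloisField 2 2

/-- The points of the projective plane over `GF(4)`, in homogeneous coordinates `[x, y, z]`. -/
abbrev Plane : Type := ℙ F4 (Fin 3 → F4)

/-- The group `PSL_3(4)`. -/
abbrev PSL34 : Type := Matrix.ProjectiveSpecialLinearGroup (Fin 3) F4

/-- The three points adjoined to the projective plane. -/
inductive NewPoint : Type
  | u
  | v
  | w

/-- The 24 points: the projective plane together with the new points `u, v, w`. -/
abbrev Point24 : Type := Plane ⊕ NewPoint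

/-- A permutation of the plane, extended to the 24 points by fixing `u, v, w`. -/
def extendPerm : Equiv.Perm Plane →* Equiv.Perm Point24 :=
  (Equiv.Perm.sumCongrHom Plane NewPoint).comp (MonoidHom.inl _ _)

/-- The action of `PSL_3(4)` on the 24 points: the natural action of matrices on column vectors
on the plane, and the trivial action on `u, v, w`. -/
def pslHom : PSL34 →* Equiv.Perm Point24 :=
  extendPerm.comp Projectivization.PSLAction.toPermHom

/-! ### Permutations given by quadratic forms in the homogeneous coordinates -/

/-- The map `[v] ↦ [f v]` on the projective plane. -/
def coordMap (f : (Fin 3 → F4) → (Fin 3 → F4)) (hs : ∀ (a : F4) v, f (a • v) = a ^ 2 • f v)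
    (h0 : ∀ v, v ≠ 0 → f v ≠ 0) : Plane → Plane :=
  Projectivization.lift (fun v => Projectivization.mk F4 (f v.1) (h0 v.1 v.2)) (by
    rintro ⟨x, hx⟩ ⟨y, hy⟩ t h
    rw [Projectivization.mk_eq_mk_iff']
    refine ⟨t ^ 2, ?_⟩
    simp only at h ⊢
    rw [h, hs])

theorem ne_zero_of_involutive (f : (Fin 3 → F4) → (Fin 3 → F4))
    (hs : ∀ (a : F4) v, f (a • v) = a ^ 2 • f v) (hf : Function.Involutive f)
    (v : Fin 3 → F4) (hv : v ≠ 0) : f v ≠ 0 := by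
  intro h
  apply hv
  have h1 : f 0 = 0 := by simpa using hs 0 0
  rw [← hf v, h, h1]

/-- The permutation `[v] ↦ [f v]` of the plane, for an involutive map `f` of the coordinates. -/
def coordPerm (f : (Fin 3 → F4) → (Fin 3 → F4)) (hs : ∀ (a : F4) v, f (a • v) = a ^ 2 • f v)
    (hf : Function.Involutive f) : Equiv.Perm Plane :=
  Function.Involutive.toPerm (coordMap f hs (ne_zero_of_involutive f hs hf)) (by
    intro p
    induction p using Projectivization.ind with
    | _ v hv =>
      simp only [coordMap, Projectivization.lift_mk]
      congr 1
      exact hf v)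

theorem pow_four (x : F4) : x ^ 4 = x := by
  have h : Nat.card F4 = 4 := by simpa using GaloisField.card 2 2 (by norm_num)
  have : Fintype F4 := Fintype.ofFinite F4
  have h2 := FiniteField.pow_card x
  rwa [← Nat.card_eq_fintype_card, h] at h2

theorem add_self (x : F4) : x + x = 0 := CharTwo.add_self_eq_zero x

theorem unit_pow_three (a : F4ˣ) : (a : F4) ^ 3 = 1 := by
  have h := pow_four (a : F4)
  have h2 : (a : F4) * ((a : F4) ^ 3 - 1) = 0 := by linear_combination h
  rcases mul_eq_zero.1 h2 with h3 | h3
  · exact absurd h3 a.ne_zero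
  · linear_combination h3

/-- The permutation `[x, y, z] ↦ [x² + yz, y², z²]` of the plane. It fixes `[1, 0, 0]`. -/
def quadPerm : Equiv.Perm Plane :=
  coordPerm (fun p => ![p 0 ^ 2 + p 1 * p 2, p 1 ^ 2, p 2 ^ 2])
    (by
      intro a p
      ext i
      fin_cases i <;> simp <;> ring)
    (by
      intro p
      ext i
      fin_cases i <;> simp
      · linear_combination pow_four (p 0) + add_self (p 0 ^ 2 * (p 1 * p 2)) +
          add_self (p 1 ^ 2 * p 2 ^ 2)
      · linear_combination pow_four (p 1)
      · linear_combination pow_four (p 2))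

/-- The permutation `[x, y, z] ↦ [x², y², a z²]` of the plane. -/
def frobPerm (a : F4ˣ) : Equiv.Perm Plane :=
  coordPerm (fun p => ![p 0 ^ 2, p 1 ^ 2, a * p 2 ^ 2])
    (by
      intro a p
      ext i
      fin_cases i <;> simp <;> ring)
    (by
      intro p
      ext i
      fin_cases i <;> simp
      · linear_combination pow_four (p 0)
      · linear_combination pow_four (p 1)
      · linear_combination pow_four (p 2) + p 2 ^ 4 * unit_pow_three a)

/-! ### The generating permutations -/

/-- The point `[1, 0, 0]`. -/
def q2 : Plane := Projectivization.mk F4 ![1, 0, 0] (by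
  intro h
  simpa using congrFun h 0)

open Classical in
/-- `S₃` interchanges `[1, 0, 0]` and `u`, fixes `v` and `w`, and sends every other point
`[x, y, z]` to `[x² + yz, y², z²]`. -/
def S3 : Equiv.Perm Point24 :=
  Equiv.swap (Sum.inl q2) (Sum.inr NewPoint.u) * extendPerm quadPerm

open Classical in
/-- `S₄` interchanges `u` and `v`, fixes `w`, and sends `[x, y, z]` to `[x², y², ζ z²]`. -/
def S4 (ζ : F4ˣ) : Equiv.Perm Point24 :=
  Equiv.swap (Sum.inr NewPoint.u) (Sum.inr NewPoint.v) * extendPerm (frobPerm ζ)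

open Classical in
/-- `S₅` interchanges `v` and `w`, fixes `u`, and sends `[x, y, z]` to `[x², y², z²]`. -/
def S5 : Equiv.Perm Point24 :=
  Equiv.swap (Sum.inr NewPoint.v) (Sum.inr NewPoint.w) * extendPerm (frobPerm 1)

/-- The Mathieu group `M₂₂`, acting on the plane and `u` (and fixing `v`, `w`):
Witt's extension of `PSL_3(4)`. -/
def M22 : Subgroup (Equiv.Perm Point24) :=
  Subgroup.closure ((pslHom.range : Set (Equiv.Perm Point24)) ∪ {S3})

/-- The Mathieu group `M₂₃`, acting on the plane, `u` and `v` (and fixing `w`):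
Witt's extension of `M₂₂`. -/
def M23 (ζ : F4ˣ) : Subgroup (Equiv.Perm Point24) :=
  Subgroup.closure ((M22 : Set (Equiv.Perm Point24)) ∪ {S4 ζ})

/-- The Mathieu group `M₂₄`, a permutation group on the 24 points: Witt's extension of `M₂₃`. -/
def M24 (ζ : F4ˣ) : Subgroup (Equiv.Perm Point24) :=
  Subgroup.closure ((M23 ζ : Set (Equiv.Perm Point24)) ∪ {S5})

theorem neg_one_eq_one : (-1 : F4) = 1 := CharTwo.neg_eq 1

/-- The matrix inducing `𝔰`. -/
def matS : Matrix.SpecialLinearGroup (Fin 3) F4 :=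
  ⟨!![1, 1, 0; 0, 1, 0; 0, 0, 1], by simp [Matrix.det_fin_three]⟩

/-- The matrix inducing `𝔧`. -/
def matJ : Matrix.SpecialLinearGroup (Fin 3) F4 :=
  ⟨!![0, 1, 0; 1, 0, 0; 0, 0, 1], by simp [Matrix.det_fin_three, neg_one_eq_one]⟩

/-- The matrix inducing `𝔱`. -/
def matT : Matrix.SpecialLinearGroup (Fin 3) F4 :=
  ⟨!![0, 0, 1; 0, 1, 0; 1, 0, 0], by simp [Matrix.det_fin_three, neg_one_eq_one]⟩

/-- The matrix inducing `𝔯`. -/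
def matR (ζ : F4ˣ) : Matrix.SpecialLinearGroup (Fin 3) F4 :=
  ⟨!![(ζ : F4), 0, 0; 0, 1, 0; 0, 0, ((ζ⁻¹ : F4ˣ) : F4)], by simp [Matrix.det_fin_three]⟩

/-! ### The presentation -/

/-- The generating symbols `𝔰, 𝔧, 𝔱, 𝔯, 𝔲, 𝔳, 𝔴`. -/
inductive Gen : Type
  | s
  | j
  | t
  | r
  | u
  | v
  | w

/-- The permutations of the 24 points denoted by the generating symbols. -/
def genPerm (ζ : F4ˣ) : Gen → Equiv.Perm Point24
  | Gen.s => pslHom (matS : PSL34)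
  | Gen.j => pslHom (matJ : PSL34)
  | Gen.t => pslHom (matT : PSL34)
  | Gen.r => pslHom (matR ζ : PSL34)
  | Gen.u => S3
  | Gen.v => S4 ζ
  | Gen.w => S5

/-- The conjugate `x ^ y = y⁻¹ x y`. -/
def cj {G : Type*} [Group G] (x y : G) : G := y⁻¹ * x * y

def s : FreeGroup Gen := FreeGroup.of Gen.s
def j : FreeGroup Gen := FreeGroup.of Gen.j
def t : FreeGroup Gen := FreeGroup.of Gen.t
def r : FreeGroup Gen := FreeGroup.of Gen.r
def u : FreeGroup Gen := FreeGroup.of Gen.u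
def v : FreeGroup Gen := FreeGroup.of Gen.v
def w : FreeGroup Gen := FreeGroup.of Gen.w

/-- The relators for `PSL_3(4)`; a relation `x = y` is given by the relator `x * y⁻¹`. -/
def relsPSL34 : Set (FreeGroup Gen) :=
  {s ^ 2, j ^ 2, t ^ 2, r ^ 3, (j * r) ^ 2, (t * r) ^ 2, (s * r) ^ 3, (j * s) ^ 3, (t * j) ^ 3,
    (t * s * t * j * s) ^ 3,
    ((t * s * t) * (j * r) * (t * s * t)) *
      ((r * s * r⁻¹ * j * r) * (t * s * t) * (r * s * r⁻¹ * j * r⁻¹ * s * r⁻¹))⁻¹}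

/-- The additional relators for `M₂₂`. -/
def relsU : Set (FreeGroup Gen) :=
  {u ^ 2, (u * s) ^ 2, (u * j) ^ 3,
    cj r u * (cj r j)⁻¹,
    cj s (t * u) * (s * cj s t)⁻¹,
    cj s (j * t * u) * (cj s (j * t) * cj s (t * j * t))⁻¹}

/-- The additional relators for `M₂₃`. -/
def relsV : Set (FreeGroup Gen) :=
  {v ^ 2, (v * s) ^ 2, (v * u) ^ 3, (v * j) ^ 2, (v * r) ^ 2,
    cj s (t * v) * (cj s (t * r))⁻¹,
    cj s (j * t * v) * (cj s (j * t * r))⁻¹}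

/-- The additional relators for `M₂₄`. -/
def relsW : Set (FreeGroup Gen) :=
  {w ^ 2, (w * r) ^ 2, (w * s) ^ 2, (w * j) ^ 2, (w * u) ^ 2, (w * cj s t) ^ 2,
    (w * cj s (j * t)) ^ 2, (w * v) ^ 3}

/-- All the relators for `M₂₄`. -/
def relsM24 : Set (FreeGroup Gen) := relsPSL34 ∪ relsU ∪ relsV ∪ relsW

end Mathieu

end

noncomputable section

/-! The permutations satisfy the relations, so there is a homomorphism φ from the presented group to
the permutations of the 24 points. Its image is M₂₄ because 𝔰, 𝔧, 𝔱, 𝔯 already yield every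
transvection and every diagonal matrix of determinant 1, hence all of SL₃(4) (`slHom_mem`). The real
content is injectivity, obtained without counting elements or enumerating cosets.

In any group with elements satisfying the relations there is a chain of subgroups `borel` ≤ `para` ≤
`linear` ≤ `deg22` ≤ `deg23` ≤ `deg24`, each obtained from its predecessor H by adjoining one
involution g: in turn k = 𝔱𝔧𝔱, 𝔧, 𝔲, 𝔳, 𝔴. At every stage gHg ⊆ H ∪ HgH, so H ∪ HgH is the whole
next group (`inCells_of_mem_sup`). For 𝔲, 𝔳, 𝔴 this is formal: H = K ∪ KhK by the previous stage, g
normalises K, and g satisfies a braid relation with h (`inCells_conj_of_braid`). For k and 𝔧 it is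
the Bruhat decomposition of a group of rank two, which rests on Chevalley's relations between the
root elements x_ij(c).

Those relations have to be extracted from a short list. Additivity in position (1, 2) comes from
(𝔰𝔯)³ = 1. The long relation and (𝔱𝔰𝔱𝔧𝔰)³ = 1 give two families of partial commutator relations
(`long_consequences`, `tstjs_consequence`); evaluating one conjugate in two ways forces 𝔰 to commute
with x₃₂(1) (`s_conj_x32`). The commutator formula `x31_x12` follows, and conjugation by 𝔧 and 𝔱
carries it to the other positions.

For the kernel, φ(H) and φ(g) are separated at each stage by a subgroup: the stabiliser of w, v, u
or [1,0,0], and finally the upper triangular image of `borel`. Hence no element of HgH is killed,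
and the kernel descends to `borel` (`mem_of_map_eq_one`). There the normal form maps to an explicit
upper triangular matrix, which is scalar only for the identity element.

That the permutations satisfy the relations is a finite check on tables of the 24 numbered points.
-/

namespace Mathieu

/-! ### A computable copy of the field with four elements -/

/-- The elements `0, 1, ζ, ζ²` of the field with four elements. -/
inductive K4 : Type
  | o
  | e
  | a
  | b
  deriving DecidableEq

namespace K4

/-- Multiplication by the primitive element. -/
def rot : K4 → K4
  | o => o
  | e => a
  | a => b
  | b => e

theorem rot_e : rot e = a := rfl
theorem rot_a : rot a = b := rfl
theorem rot_b : rot b = e := rfl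

/-- Addition. -/
def add : K4 → K4 → K4
  | o, x => x
  | x, o => x
  | e, e => o
  | e, a => b
  | e, b => a
  | a, e => b
  | a, a => o
  | a, b => e
  | b, e => a
  | b, a => e
  | b, b => o

/-- Multiplication. -/
def mul : K4 → K4 → K4
  | o, _ => o
  | e, x => x
  | a, x => x.rot
  | b, x => x.rot.rot

end K4

/-! ### Double cosets of a subgroup and an involution -/

section DoubleCoset

variable {G : Type*} [Group G]

/-- `x` lies in `H ∪ H g H`. -/
def InCells (H : Subgroup G) (g x : G) : Prop :=
  x ∈ H ∨ ∃ a ∈ H, ∃ b ∈ H, x = a * g * b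

/-- The hypothesis on g makes H ∪ HgH stable under right multiplication by H and by g; since it
contains 1, it contains everything they generate. -/
theorem inCells_of_mem_sup {H : Subgroup G} {g : G} (hg : g * g = 1)
    (h : ∀ x ∈ H, InCells H g (g * x * g)) {x : G} (hx : x ∈ H ⊔ Subgroup.zpowers g) :
    InCells H g x := by
  have hg' : g⁻¹ = g := inv_eq_of_mul_eq_one_left hg
  have step : ∀ y, InCells H g y → InCells H g (y * g) := by
    rintro y (hy | ⟨a, ha, b, hb, rfl⟩)
    · exact Or.inr ⟨y, hy, 1, H.one_mem, by simp⟩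
    · rcases h b hb with hc | ⟨c, hc, d, hd, he⟩
      · left
        have := H.mul_mem ha hc
        simpa [mul_assoc] using this
      · right
        refine ⟨a * c, H.mul_mem ha hc, d, hd, ?_⟩
        calc a * g * b * g = a * (g * b * g) := by group
          _ = _ := by rw [he]; group
  rw [← Subgroup.closure_eq H, Subgroup.zpowers_eq_closure, ← Subgroup.closure_union] at hx
  have stepH : ∀ y, InCells H g y → ∀ b ∈ H, InCells H g (y * b) := by
    rintro y (hy | ⟨a, ha, c, hc, rfl⟩) b hb
    · exact Or.inl (H.mul_mem hy hb)
    · exact Or.inr ⟨a, ha, c * b, H.mul_mem hc hb, by group⟩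
  induction hx using Subgroup.closure_induction_right with
  | one => exact Or.inl H.one_mem
  | mul_right y z _ hz ih =>
    rcases hz with hz | rfl
    · exact stepH _ ih _ hz
    · exact step _ ih
  | mul_inv_cancel y z _ hz ih =>
    rcases hz with hz | rfl
    · exact stepH _ ih _ (H.inv_mem hz)
    · rw [hg']; exact step _ ih

/-- If `H = K ∪ K h K`, `g` normalises `K` and satisfies the braid relation with `h`, then
conjugation by `g` maps `H` into `H ∪ H g H`. -/
theorem inCells_conj_of_braid {K H : Subgroup G} {g h : G} (hKH : K ≤ H) (hh : h ∈ H)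
    (hg : g * g = 1) (hH : ∀ x ∈ H, InCells K h x) (hK : ∀ x ∈ K, g * x * g ∈ K)
    (hb : g * h * g = h * g * h) : ∀ x ∈ H, InCells H g (g * x * g) := by
  intro x hx
  rcases hH x hx with hx | ⟨a, ha, b, hb', rfl⟩
  · exact Or.inl (hKH (hK x hx))
  · right
    refine ⟨g * a * g * h, H.mul_mem (hKH (hK a ha)) hh, h * (g * b * g),
      H.mul_mem hh (hKH (hK b hb')), ?_⟩
    have e : g * (a * h * b) * g = (g * a * g) * (g * h * g) * (g * b * g) := by
      have e1 : ∀ y, g * (g * y) = y := fun y => by rw [← mul_assoc, hg, one_mul]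
      simp only [mul_assoc, e1]
    rw [e, hb]
    group

/-- A kernel element of `H ∪ H g H` lies in `H`, if the images of `H` and `g` are separated by a
subgroup. -/
theorem mem_of_map_eq_one {M : Type*} [Group M] (φ : G →* M) {H : Subgroup G} {g x : G}
    (L : Subgroup M) (hH : ∀ y ∈ H, φ y ∈ L) (hg : φ g ∉ L) (hx : InCells H g x)
    (h1 : φ x = 1) : x ∈ H := by
  rcases hx with hx | ⟨a, ha, b, hb, rfl⟩
  · exact hx
  · exfalso
    apply hg
    have : φ g = (φ a)⁻¹ * (φ b)⁻¹ := by
      rw [map_mul, map_mul] at h1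
      have h2 := eq_inv_of_mul_eq_one_left h1
      rw [← h2]
      group
    rw [this]
    exact L.mul_mem (L.inv_mem (hH a ha)) (L.inv_mem (hH b hb))

end DoubleCoset

/-! ### The linear relations -/

/-- Elements of a group that satisfy the relations of `PSL_3(4)`. -/
structure LinearTuple (G : Type*) [Group G] where
  s : G
  j : G
  t : G
  r : G
  s_sq : s ^ 2 = 1
  j_sq : j ^ 2 = 1
  t_sq : t ^ 2 = 1
  r_cube : r ^ 3 = 1
  jr_sq : (j * r) ^ 2 = 1
  tr_sq : (t * r) ^ 2 = 1
  sr_cube : (s * r) ^ 3 = 1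
  js_cube : (j * s) ^ 3 = 1
  tj_cube : (t * j) ^ 3 = 1
  tstjs_cube : (t * s * t * j * s) ^ 3 = 1
  long : (t * s * t) * (j * r) * (t * s * t) =
    (r * s * r⁻¹ * j * r) * (t * s * t) * (r * s * r⁻¹ * j * r⁻¹ * s * r⁻¹)

namespace LinearTuple

variable {G : Type*} [Group G] (P : LinearTuple G)

theorem s_mul_s : P.s * P.s = 1 := by rw [← pow_two, P.s_sq]
theorem j_mul_j : P.j * P.j = 1 := by rw [← pow_two, P.j_sq]
theorem t_mul_t : P.t * P.t = 1 := by rw [← pow_two, P.t_sq]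
theorem inv_s : P.s⁻¹ = P.s := inv_eq_of_mul_eq_one_left P.s_mul_s
theorem inv_j : P.j⁻¹ = P.j := inv_eq_of_mul_eq_one_left P.j_mul_j
theorem inv_t : P.t⁻¹ = P.t := inv_eq_of_mul_eq_one_left P.t_mul_t
theorem r_mul_r : P.r * P.r = P.r⁻¹ :=
  eq_inv_of_mul_eq_one_left (by rw [← pow_two, ← pow_succ, P.r_cube])

/-- Conjugation by `j`. -/
def cJ : G ≃* G := MulAut.conj P.j
/-- Conjugation by `t`. -/
def cT : G ≃* G := MulAut.conj P.t
/-- Conjugation by `r`. -/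
def cR : G ≃* G := MulAut.conj P.r

theorem cJ_apply (x : G) : P.cJ x = P.j * x * P.j := by
  rw [cJ, MulAut.conj_apply, P.inv_j]
theorem cT_apply (x : G) : P.cT x = P.t * x * P.t := by
  rw [cT, MulAut.conj_apply, P.inv_t]
theorem cR_apply (x : G) : P.cR x = P.r * x * P.r⁻¹ := rfl

theorem cJ_cJ (x : G) : P.cJ (P.cJ x) = x := by
  have h := P.j_mul_j
  rw [cJ_apply, cJ_apply]
  calc P.j * (P.j * x * P.j) * P.j = (P.j * P.j) * x * (P.j * P.j) := by group
    _ = x := by rw [h]; group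
theorem cT_cT (x : G) : P.cT (P.cT x) = x := by
  have h := P.t_mul_t
  rw [cT_apply, cT_apply]
  calc P.t * (P.t * x * P.t) * P.t = (P.t * P.t) * x * (P.t * P.t) := by group
    _ = x := by rw [h]; group

theorem cJ_r : P.cJ P.r = P.r⁻¹ := by
  have h := P.jr_sq
  rw [pow_two] at h
  rw [cJ_apply]
  exact eq_inv_of_mul_eq_one_left (by rw [← h]; group)
theorem cT_r : P.cT P.r = P.r⁻¹ := by
  have h := P.tr_sq
  rw [pow_two] at h
  rw [cT_apply]
  exact eq_inv_of_mul_eq_one_left (by rw [← h]; group)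

theorem jtj : P.j * P.t * P.j = P.t * P.j * P.t := by
  have h := P.tj_cube
  have h1 : (P.j * P.t * P.j)⁻¹ = P.t * P.j * P.t := by
    apply inv_eq_of_mul_eq_one_left
    rw [← h, pow_succ, pow_two]; simp only [mul_assoc]
  rw [← h1]
  simp only [mul_inv_rev, P.inv_j, P.inv_t, mul_assoc]

theorem cR_cR_cR (x : G) : P.cR (P.cR (P.cR x)) = x := by
  have h : P.r * P.r * P.r = 1 := by rw [← P.r_cube, pow_succ, pow_two]
  have h' : P.r⁻¹ * P.r⁻¹ * P.r⁻¹ = 1 := by rw [← mul_inv_rev, ← mul_inv_rev, ← mul_assoc, h, inv_one]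
  simp only [cR_apply]
  calc _ = P.r * P.r * P.r * x * (P.r⁻¹ * P.r⁻¹ * P.r⁻¹) := by group
    _ = x := by rw [h, h']; group

theorem cR_cR (x : G) : P.cR (P.cR x) = P.r⁻¹ * x * P.r := by
  have h := P.cR_cR_cR x
  rw [cR_apply] at h
  calc P.cR (P.cR x) = P.r⁻¹ * (P.r * P.cR (P.cR x) * P.r⁻¹) * P.r := by group
    _ = _ := by rw [h]

/-- `j` inverts `r`, and r⁻¹ = r², so moving conjugation by `r` past `j` doubles it; the same holds
for `t`. -/
theorem cR_cJ (x : G) : P.cR (P.cJ x) = P.cJ (P.cR (P.cR x)) := by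
  rw [cR_cR, map_mul, map_mul, map_inv, cJ_r, inv_inv, cR_apply]
theorem cR_cT (x : G) : P.cR (P.cT x) = P.cT (P.cR (P.cR x)) := by
  rw [cR_cR, map_mul, map_mul, map_inv, cT_r, inv_inv, cR_apply]
theorem cJ_cT_cJ (x : G) : P.cJ (P.cT (P.cJ x)) = P.cT (P.cJ (P.cT x)) := by
  have h := P.jtj
  simp only [cJ_apply, cT_apply]
  calc _ = P.j * P.t * P.j * x * (P.j * P.t * P.j) := by group
    _ = _ := by rw [h]; group

/-- The root element `x_{12}(c)`; the other root elements are its conjugates under `j` and `t`. -/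
def x12 : K4 → G
  | K4.o => 1
  | K4.e => P.s
  | K4.a => P.cR P.s
  | K4.b => P.cR (P.cR P.s)
def x32 (c : K4) : G := P.cT (P.x12 c)
def x31 (c : K4) : G := P.cJ (P.x32 c)
def x13 (c : K4) : G := P.cT (P.x31 c)
def x21 (c : K4) : G := P.cJ (P.x12 c)
def x23 (c : K4) : G := P.cT (P.x21 c)

theorem cJ_x12 (c : K4) : P.cJ (P.x12 c) = P.x21 c := rfl
theorem cJ_x21 (c : K4) : P.cJ (P.x21 c) = P.x12 c := P.cJ_cJ _
theorem cJ_x32 (c : K4) : P.cJ (P.x32 c) = P.x31 c := rfl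
theorem cJ_x31 (c : K4) : P.cJ (P.x31 c) = P.x32 c := P.cJ_cJ _
theorem cT_x12 (c : K4) : P.cT (P.x12 c) = P.x32 c := rfl
theorem cT_x32 (c : K4) : P.cT (P.x32 c) = P.x12 c := P.cT_cT _
theorem cT_x31 (c : K4) : P.cT (P.x31 c) = P.x13 c := rfl
theorem cT_x13 (c : K4) : P.cT (P.x13 c) = P.x31 c := P.cT_cT _
theorem cT_x21 (c : K4) : P.cT (P.x21 c) = P.x23 c := rfl
theorem cT_x23 (c : K4) : P.cT (P.x23 c) = P.x21 c := P.cT_cT _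
theorem cJ_x13 (c : K4) : P.cJ (P.x13 c) = P.x23 c := by
  rw [x13, x31, cJ_cT_cJ, x32, cT_cT, x23, x21]
theorem cJ_x23 (c : K4) : P.cJ (P.x23 c) = P.x13 c := by
  rw [← cJ_x13, cJ_cJ]

/-- Here and below the number of rotations is read off from r = diag(ζ, 1, ζ⁻¹): position (i, k) is
scaled by the quotient of the i-th and k-th diagonal entries, with ζ³ = 1. -/
theorem cR_x12 (c : K4) : P.cR (P.x12 c) = P.x12 c.rot := by
  cases c
  · exact map_one _
  · rfl
  · rfl
  · exact P.cR_cR_cR _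
theorem cR_x32 (c : K4) : P.cR (P.x32 c) = P.x32 c.rot.rot := by
  rw [x32, cR_cT, cR_x12, cR_x12, x32]
theorem rot_rot_rot (c : K4) : c.rot.rot.rot = c := by cases c <;> rfl
theorem cR_x31 (c : K4) : P.cR (P.x31 c) = P.x31 c.rot := by
  rw [x31, cR_cJ, cR_x32, cR_x32, rot_rot_rot, x31]
theorem cR_x21 (c : K4) : P.cR (P.x21 c) = P.x21 c.rot.rot := by
  rw [x21, cR_cJ, cR_x12, cR_x12, x21]
theorem cR_x23 (c : K4) : P.cR (P.x23 c) = P.x23 c.rot := by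
  rw [x23, cR_cT, cR_x21, cR_x21, rot_rot_rot, x23]

theorem x12_zero : P.x12 K4.o = 1 := rfl
theorem x12_one : P.x12 K4.e = P.s := rfl

theorem x12_mul_self (c : K4) : P.x12 c * P.x12 c = 1 := by
  have h := P.s_mul_s
  cases c
  · exact one_mul _
  · exact h
  · simp only [x12, ← map_mul, h, map_one]
  · simp only [x12, ← map_mul, h, map_one]

theorem inv_x12 (c : K4) : (P.x12 c)⁻¹ = P.x12 c := inv_eq_of_mul_eq_one_left (P.x12_mul_self c)

/-- The product of the three conjugates of `s` under powers of `r` telescopes to (sr)³r⁻³ = 1. -/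
theorem x12_triple : P.x12 K4.e * P.x12 K4.a = P.x12 K4.b := by
  have h := P.sr_cube
  have h2 : P.x12 K4.e * P.x12 K4.a * P.x12 K4.b = 1 := by
    simp only [x12, cR_apply]
    calc P.s * (P.r * P.s * P.r⁻¹) * (P.r * (P.r * P.s * P.r⁻¹) * P.r⁻¹)
        = (P.s * P.r) ^ 3 * (P.r ^ 3)⁻¹ := by
          simp only [pow_succ, pow_zero, one_mul, mul_inv_rev, mul_assoc, mul_inv_cancel_left,
            inv_mul_cancel_left]
      _ = 1 := by rw [h, P.r_cube, inv_one, one_mul]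
  rw [← P.inv_x12 K4.b]
  exact eq_inv_of_mul_eq_one_left h2

/-- The root elements in position `(1, 2)` form a copy of the additive group. -/
theorem x12_add (c d : K4) : P.x12 c * P.x12 d = P.x12 (c.add d) := by
  have h1 := P.x12_triple
  have h2 : P.x12 K4.a * P.x12 K4.b = P.x12 K4.e := by
    simpa only [map_mul, cR_x12, K4.rot_e, K4.rot_a, K4.rot_b] using congrArg P.cR h1
  have h3 : P.x12 K4.b * P.x12 K4.e = P.x12 K4.a := by
    simpa only [map_mul, cR_x12, K4.rot_e, K4.rot_a, K4.rot_b] using congrArg P.cR h2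
  have i1 := congrArg (·⁻¹) h1
  have i2 := congrArg (·⁻¹) h2
  have i3 := congrArg (·⁻¹) h3
  simp only [mul_inv_rev, inv_x12] at i1 i2 i3
  cases c <;> cases d <;>
    first
      | exact one_mul _ | exact mul_one _ | exact P.x12_mul_self _ | assumption

theorem x32_add (c d : K4) : P.x32 c * P.x32 d = P.x32 (c.add d) := by
  rw [x32, x32, ← map_mul, x12_add, x32]
theorem x31_add (c d : K4) : P.x31 c * P.x31 d = P.x31 (c.add d) := by
  rw [x31, x31, ← map_mul, x32_add, x31]
theorem x13_add (c d : K4) : P.x13 c * P.x13 d = P.x13 (c.add d) := by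
  rw [x13, x13, ← map_mul, x31_add, x13]
theorem x23_add (c d : K4) : P.x23 c * P.x23 d = P.x23 (c.add d) := by
  rw [x23, x23, x21, x21, ← map_mul, ← map_mul, x12_add, x23, x21]
theorem x32_zero : P.x32 K4.o = 1 := map_one _
theorem x31_zero : P.x31 K4.o = 1 := by rw [x31, x32_zero, map_one]
theorem x13_zero : P.x13 K4.o = 1 := by rw [x13, x31_zero, map_one]
theorem x23_zero : P.x23 K4.o = 1 := by rw [x23, x21, x12_zero, map_one, map_one]
theorem x32_mul_self (c : K4) : P.x32 c * P.x32 c = 1 := by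
  rw [x32, ← map_mul, x12_mul_self, map_one]
theorem x31_mul_self (c : K4) : P.x31 c * P.x31 c = 1 := by
  rw [x31, ← map_mul, x32_mul_self, map_one]

end LinearTuple

/-! ### Consequences of the long relation for involutions -/

section Involutions

variable {G : Type*} [Group G]

theorem commute_of_involutions {x y : G} (hx : x * x = 1) (hy : y * y = 1)
    (hxy : x * y * (x * y) = 1) : x * y = y * x := by
  have h := eq_inv_of_mul_eq_one_left hxy
  rwa [mul_inv_rev, inv_eq_of_mul_eq_one_left hx, inv_eq_of_mul_eq_one_left hy] at h

theorem conj_mul_self {x y : G} (hx : x * x = 1) (hy : y * y = 1) :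
    x * y * x * (x * y * x) = 1 := by
  calc x * y * x * (x * y * x) = x * y * (x * x) * y * x := by group
    _ = 1 := by rw [hx, mul_one, mul_assoc x y y, hy, mul_one, hx]

/-- In the alternating group relations for `g, x`, the relation `z g z = x g z x g x` forces `x` to
commute with `z`. -/
theorem commute_of_long_relation {z g x : G} (hz : z * z = 1) (hg : g * g = 1) (hx : x * x = 1)
    (hgx : g * x * g = x * g * x) (h : z * g * z = x * g * z * x * g * x) :
    z * (g * z * g) = x * (g * z * g) * x ∧ z * (g * z * g) = (g * z * g) * z ∧
      x * z = z * x := by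
  have c1 : ∀ y, g * (g * y) = y := fun y => by rw [← mul_assoc, hg, one_mul]
  have hgx' : x * g * x * g = g * x := by rw [← hgx, mul_assoc, hg, mul_one]
  -- Multiply the long relation by g on the right and replace xgxg by gx.
  have h1 : z * (g * z * g) = x * (g * z * g) * x := by
    calc z * (g * z * g) = (z * g * z) * g := by group
      _ = x * g * z * (x * g * x * g) := by rw [h]; group
      _ = x * (g * z * g) * x := by rw [hgx']; group
  have hw : g * z * g * (g * z * g) = 1 := conj_mul_self hg hz
  -- By `h1` this product of two involutions is conjugate to an involution, so the two factors
  -- commute.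
  have h2 : z * (g * z * g) = (g * z * g) * z := by
    apply commute_of_involutions hz hw
    rw [h1]
    exact conj_mul_self hx hw
  refine ⟨h1, h2, ?_⟩
  -- Conjugation by g swaps the commuting factors z and gzg and so fixes the left side of `h1`.
  -- Comparing with the conjugated right side, where gxg = xgx, leaves z = xzx after cancellation.
  have h3 : g * (z * (g * z * g)) * g = g * (x * (g * z * g) * x) * g := by rw [h1]
  have h4 : g * (x * (g * z * g) * x) * g = (g * x * g) * z * (g * x * g) := by group
  have h5 : g * (z * (g * z * g)) * g = x * (g * z * g) * x := by
    rw [← h1]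
    calc g * (z * (g * z * g)) * g = g * ((g * z * g) * z) * g := by rw [h2]
      _ = _ := by simp only [mul_assoc, c1]
  rw [h4, h5, hgx] at h3
  have h6 : x * (g * z * g) * x = x * (g * (x * z * x) * g) * x := by
    rw [h3]; group
  have h7 : z = x * z * x := by
    have := mul_left_cancel (mul_right_cancel h6)
    exact mul_left_cancel (mul_right_cancel this)
  nth_rw 2 [h7]
  rw [mul_assoc (x * z), hx, mul_one]

end Involutions

/-! ### Chevalley commutator relations -/

namespace LinearTuple

variable {G : Type*} [Group G] (P : LinearTuple G)

theorem j_mul_r_sq : P.j * P.r * (P.j * P.r) = 1 := by rw [← pow_two, P.jr_sq]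

theorem j_mul_r : P.j * P.r = P.r⁻¹ * P.j := by
  rw [← cJ_r, cJ_apply, mul_assoc, P.j_mul_j, mul_one]

theorem cR_j : P.cR P.j = P.j * P.r := by
  have h : P.r * P.j = P.j * P.r⁻¹ := by
    rw [← cJ_r, cJ_apply, ← mul_assoc, ← mul_assoc, P.j_mul_j, one_mul]
  rw [cR_apply, h, mul_assoc, ← mul_inv_rev, P.r_mul_r, inv_inv]

theorem jsj : P.j * P.s * P.j = P.s * P.j * P.s := by
  have h := P.js_cube
  have h1 : (P.j * P.s * P.j)⁻¹ = P.s * P.j * P.s := by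
    apply inv_eq_of_mul_eq_one_left
    rw [← h, pow_succ, pow_two]
    have e : ∀ a b : G, a * b * (a * b) * (a * b) = 1 ↔ b * a * b * (a * b * a) = 1 := by
      intro a b
      rw [show b * a * b * (a * b * a) = a⁻¹ * (a * b * (a * b) * (a * b)) * a by group]
      constructor
      · intro h; rw [h]; group
      · intro h
        rw [show a * b * (a * b) * (a * b) =
          a * (a⁻¹ * (a * b * (a * b) * (a * b)) * a) * a⁻¹ by group, h]
        group
    have h2 : P.j * P.s * (P.j * P.s) * (P.j * P.s) = 1 := by rw [← h, pow_succ, pow_two]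
    rw [h2]
    exact (e _ _).1 h2
  rw [← h1]
  simp only [mul_inv_rev, P.inv_j, P.inv_s, mul_assoc]

/-- The long relation is the hypothesis of `commute_of_long_relation` for z = tst = x₃₂(1), g = jr
and x = rsr⁻¹ = x₁₂(ζ). Here gzg = x₃₁(ζ²), and the braid relation of g and x is that of j and s
conjugated by r. -/
theorem long_consequences :
    P.x32 K4.e * P.x31 K4.b = P.x12 K4.a * P.x31 K4.b * P.x12 K4.a ∧
      P.x32 K4.e * P.x31 K4.b = P.x31 K4.b * P.x32 K4.e ∧
      P.x12 K4.a * P.x32 K4.e = P.x32 K4.e * P.x12 K4.a := by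
  have hz : P.t * P.s * P.t = P.x32 K4.e := (P.cT_apply _).symm
  have hx : P.r * P.s * P.r⁻¹ = P.x12 K4.a := rfl
  have hw : P.j * P.r * P.x32 K4.e * (P.j * P.r) = P.x31 K4.b := by
    nth_rw 2 [P.j_mul_r]
    calc _ = P.j * P.cR (P.x32 K4.e) * P.j := by rw [cR_apply]; group
      _ = _ := by rw [cR_x32, ← cJ_apply]; rfl
  have hgx : P.j * P.r * P.x12 K4.a * (P.j * P.r) = P.x12 K4.a * (P.j * P.r) * P.x12 K4.a := by
    have := congrArg P.cR P.jsj
    simpa only [map_mul, cR_j, ← P.x12_one, cR_x12, K4.rot_e] using this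
  rw [← hw]
  apply commute_of_long_relation (P.x32_mul_self _) P.j_mul_r_sq (P.x12_mul_self _) hgx
  rw [← hz, ← hx]
  have h := P.long
  have e : P.j * P.r⁻¹ * P.s = P.j * P.r * (P.r * P.s) := by
    rw [← P.r_mul_r]; simp only [mul_assoc]
  have e' : P.r * P.s * P.r⁻¹ * P.j * P.r⁻¹ * P.s * P.r⁻¹ =
      P.r * P.s * P.r⁻¹ * (P.j * P.r⁻¹ * P.s) * P.r⁻¹ := by simp only [mul_assoc]
  rw [h, e', e]
  simp only [mul_assoc]

/-- Reading (zjs)³ = 1 with z = x₃₂(1) and jsj = sjs gives a product of three involutions equal to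
1, so the first two commute. Once szs = z is known, this becomes the commutator formula for x₁₂(1)
and x₃₁(1). -/
theorem tstjs_consequence :
    P.s * P.x31 K4.e * P.s = P.x32 K4.e * P.cJ (P.s * P.x32 K4.e * P.s) ∧
      P.x32 K4.e * P.cJ (P.s * P.x32 K4.e * P.s) =
        P.cJ (P.s * P.x32 K4.e * P.s) * P.x32 K4.e := by
  have hz : P.t * P.s * P.t = P.x32 K4.e := (P.cT_apply _).symm
  have h := P.tstjs_cube
  rw [hz, pow_succ, pow_two] at h
  set z := P.x32 K4.e with hzz
  have hjs := P.jsj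
  have h1 : z * P.cJ (P.s * z * P.s) * (P.s * P.x31 K4.e * P.s) = 1 := by
    rw [x31, cJ_apply, cJ_apply, ← hzz]
    calc _ = z * P.j * P.s * z * (P.s * P.j * P.s) * P.j * z * P.j * P.s := by group
      _ = z * P.j * P.s * z * P.j * P.s * (P.j * P.j) * z * P.j * P.s := by rw [← hjs]; group
      _ = 1 := by rw [P.j_mul_j, mul_one, ← h]; simp only [mul_assoc]
  have i1 : z * z = 1 := P.x32_mul_self _
  have i2 : P.cJ (P.s * z * P.s) * P.cJ (P.s * z * P.s) = 1 := by
    rw [← map_mul, conj_mul_self P.s_mul_s i1, map_one]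
  have i3 : P.s * P.x31 K4.e * P.s * (P.s * P.x31 K4.e * P.s) = 1 :=
    conj_mul_self P.s_mul_s (P.x31_mul_self _)
  have h2 : z * P.cJ (P.s * z * P.s) = P.s * P.x31 K4.e * P.s := by
    rw [eq_inv_of_mul_eq_one_left h1, inv_eq_of_mul_eq_one_left i3]
  refine ⟨h2.symm, commute_of_involutions i1 i2 ?_⟩
  rw [h2, i3]

/-- Root elements in one column commute: the basic case. -/
theorem s_conj_x32 : P.s * P.x32 K4.e * P.s = P.x32 K4.e := by
  obtain ⟨b1, b2, b3⟩ := P.long_consequences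
  obtain ⟨c1, c2⟩ := P.tstjs_consequence
  set V := P.s * P.x32 K4.e * P.s with hV
  have b1' : P.x32 K4.a * P.x31 K4.a = P.s * P.x31 K4.a * P.s := by
    simpa only [map_mul, cR_x12, cR_x31, cR_x32, K4.rot_e, K4.rot_a, K4.rot_b, x12_one] using
      congrArg P.cR (congrArg P.cR b1)
  have b2' : P.x32 K4.a * P.x31 K4.a = P.x31 K4.a * P.x32 K4.a := by
    simpa only [map_mul, cR_x12, cR_x31, cR_x32, K4.rot_e, K4.rot_a, K4.rot_b, x12_one] using
      congrArg P.cR (congrArg P.cR b2)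
  have b3' : P.x12 K4.b * P.x32 K4.b = P.x32 K4.b * P.x12 K4.b := by
    simpa only [map_mul, cR_x12, cR_x31, cR_x32, K4.rot_e, K4.rot_a, K4.rot_b, x12_one] using congrArg P.cR b3
  have b3'' : P.s * P.x32 K4.a = P.x32 K4.a * P.s := by
    simpa only [map_mul, cR_x12, cR_x31, cR_x32, K4.rot_e, K4.rot_a, K4.rot_b, x12_one] using congrArg P.cR (congrArg P.cR b3)
  have hc : P.cR (P.cR (P.cJ V)) = P.cJ (P.cR V) := by
    rw [cR_cJ, cR_cJ, cR_cR_cR]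
  have c1' : P.x12 K4.b * P.x31 K4.b * P.x12 K4.b = P.x32 K4.a * P.cJ (P.cR V) := by
    have := congrArg P.cR (congrArg P.cR c1)
    rw [map_mul, map_mul, map_mul, map_mul, map_mul P.cR, map_mul P.cR, hc] at this
    simpa only [← x12_one, cR_x12, cR_x31, cR_x32, K4.rot_e, K4.rot_a, K4.rot_b] using this
  have c2' : P.x32 K4.a * P.cJ (P.cR V) = P.cJ (P.cR V) * P.x32 K4.a := by
    have := congrArg P.cR (congrArg P.cR c2)
    rw [map_mul P.cR, map_mul P.cR, map_mul P.cR, map_mul P.cR, hc] at this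
    simpa only [← x12_one, cR_x12, cR_x31, cR_x32, K4.rot_e, K4.rot_a, K4.rot_b] using this
  have hss := P.s_mul_s
  -- Uses the rotated commutations `b3''` and `b3'`: first x₃₂(ζ) is pulled through s, then x₁₂(ζ²)²
  -- = 1 is inserted next to x₃₂(ζ²), turning both outer factors s into x₁₂(ζ).
  have hV1 : V * P.x32 K4.a = P.cR V := by
    have e : P.cR V = P.x12 K4.a * P.x32 K4.b * P.x12 K4.a := by
      rw [hV, map_mul, map_mul, ← x12_one, cR_x12, cR_x32]; rfl
    have e1 : P.s * P.x12 K4.b = P.x12 K4.a := P.x12_add K4.e K4.b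
    have e2 : P.x12 K4.b * P.s = P.x12 K4.a := P.x12_add K4.b K4.e
    rw [e]
    calc V * P.x32 K4.a = P.s * P.x32 K4.e * (P.s * P.x32 K4.a) := by rw [hV]; group
      _ = P.s * (P.x32 K4.e * P.x32 K4.a) * P.s := by rw [b3'']; group
      _ = P.s * P.x32 K4.b * P.s := by rw [x32_add]; rfl
      _ = P.s * (P.x32 K4.b * (P.x12 K4.b * P.x12 K4.b)) * P.s := by rw [x12_mul_self, mul_one]
      _ = P.s * (P.x12 K4.b * P.x32 K4.b) * P.x12 K4.b * P.s := by rw [b3']; group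
      _ = (P.s * P.x12 K4.b) * P.x32 K4.b * (P.x12 K4.b * P.s) := by group
      _ = _ := by rw [e1, e2]
  -- The second evaluation; x₃₁(ζ²) is split as x₃₁(1)·x₃₁(ζ) so that each factor can be conjugated
  -- by s separately.
  have key : P.x12 K4.b * P.x31 K4.b * P.x12 K4.b = V * P.x32 K4.e * (P.cJ (P.cR V) * P.x32 K4.a) := by
    have e1 : P.x12 K4.b = P.s * P.x12 K4.a := (P.x12_add K4.e K4.a).symm
    have e2 : P.x12 K4.b = P.x12 K4.a * P.s := (P.x12_add K4.a K4.e).symm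
    have e3 : P.x31 K4.e * P.x31 K4.a = P.x31 K4.b := P.x31_add K4.e K4.a
    calc P.x12 K4.b * P.x31 K4.b * P.x12 K4.b
        = P.s * (P.x12 K4.a * P.x31 K4.b * P.x12 K4.a) * P.s := by
          nth_rw 1 [e1]; rw [e2]; group
      _ = P.s * P.x32 K4.e * (P.s * P.s) * P.x31 K4.b * P.s := by rw [← b1, hss]; group
      _ = V * P.s * (P.x31 K4.e * P.x31 K4.a) * P.s := by rw [hV, e3]; group
      _ = V * P.s * (P.x31 K4.e * (P.s * P.s) * P.x31 K4.a) * P.s := by rw [hss, mul_one]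
      _ = V * (P.s * P.x31 K4.e * P.s) * (P.s * P.x31 K4.a * P.s) := by group
      _ = V * (P.x32 K4.e * P.cJ V) * (P.x31 K4.a * P.x32 K4.a) := by rw [c1, ← b1', b2']
      _ = V * P.x32 K4.e * (P.cJ V * P.cJ (P.x32 K4.a)) * P.x32 K4.a := by rw [cJ_x32]; group
      _ = _ := by rw [← map_mul, hV1]; group
  rw [c1', c2'] at key
  have h1 : V * P.x32 K4.e = 1 := by
    have : 1 * (P.cJ (P.cR V) * P.x32 K4.a) = V * P.x32 K4.e * (P.cJ (P.cR V) * P.x32 K4.a) := by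
      rw [one_mul]; exact key
    exact (mul_right_cancel this).symm
  rw [eq_inv_of_mul_eq_one_left h1, inv_eq_of_mul_eq_one_left (P.x32_mul_self _)]

/-- For c = 1 the parameters d = 1 and d = ζ come from `tstjs_consequence` and `long_consequences`,
and d = ζ² by additivity. Conjugation by r then moves c through all nonzero values. -/
theorem x31_x12 (c d : K4) :
    P.x12 c * P.x31 d * P.x12 c = P.x32 (c.mul d) * P.x31 d := by
  have hV := P.s_conj_x32
  have a0 : P.x12 K4.e * P.x31 K4.e * P.x12 K4.e = P.x32 K4.e * P.x31 K4.e := by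
    have := P.tstjs_consequence.1
    rw [hV] at this
    exact this
  have a1 : P.x12 K4.e * P.x31 K4.a * P.x12 K4.e = P.x32 K4.a * P.x31 K4.a := by
    have := congrArg P.cR (congrArg P.cR P.long_consequences.1)
    simpa only [map_mul, cR_x12, cR_x31, cR_x32, K4.rot_e, K4.rot_a, K4.rot_b] using this.symm
  have comm : P.x32 K4.a * P.x31 K4.e = P.x31 K4.e * P.x32 K4.a := by
    have c0 : P.x32 K4.e * P.x31 K4.e = P.x31 K4.e * P.x32 K4.e := by
      have := P.tstjs_consequence.2
      rwa [hV] at this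
    have c1 : P.x32 K4.b * P.x31 K4.e = P.x31 K4.e * P.x32 K4.b := by
      have := congrArg P.cR P.long_consequences.2.1
      simpa only [map_mul, cR_x12, cR_x31, cR_x32, K4.rot_e, K4.rot_a, K4.rot_b] using this
    have e : P.x32 K4.a = P.x32 K4.e * P.x32 K4.b := (P.x32_add K4.e K4.b).symm
    rw [e, mul_assoc, c1, ← mul_assoc, c0, mul_assoc]
  have a2 : P.x12 K4.e * P.x31 K4.b * P.x12 K4.e = P.x32 K4.b * P.x31 K4.b := by
    have e : P.x31 K4.b = P.x31 K4.e * P.x31 K4.a := (P.x31_add K4.e K4.a).symm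
    have e' : P.x32 K4.b = P.x32 K4.e * P.x32 K4.a := (P.x32_add K4.e K4.a).symm
    calc _ = P.x12 K4.e * P.x31 K4.e * (P.x12 K4.e * P.x12 K4.e) * P.x31 K4.a * P.x12 K4.e := by
          rw [e, x12_mul_self]; group
      _ = (P.x12 K4.e * P.x31 K4.e * P.x12 K4.e) * (P.x12 K4.e * P.x31 K4.a * P.x12 K4.e) := by
          group
      _ = P.x32 K4.e * (P.x31 K4.e * P.x32 K4.a) * P.x31 K4.a := by rw [a0, a1]; group
      _ = _ := by rw [← comm, e, e']; group
  have b : ∀ d, P.x12 K4.e * P.x31 d * P.x12 K4.e = P.x32 d * P.x31 d := by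
    intro d; cases d
    · rw [x31_zero, x32_zero, mul_one, x12_mul_self, one_mul]
    · exact a0
    · exact a1
    · exact a2
  have b' : ∀ d, P.x12 K4.a * P.x31 d * P.x12 K4.a = P.x32 d.rot * P.x31 d := by
    intro d
    have := congrArg P.cR (b d.rot.rot)
    simpa only [map_mul, cR_x12, cR_x31, cR_x32, K4.rot_e, K4.rot_a, K4.rot_b, rot_rot_rot] using this
  have b'' : ∀ d, P.x12 K4.b * P.x31 d * P.x12 K4.b = P.x32 d.rot.rot * P.x31 d := by
    intro d
    have := congrArg P.cR (b' d.rot.rot)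
    simpa only [map_mul, cR_x12, cR_x31, cR_x32, K4.rot_e, K4.rot_a, K4.rot_b, rot_rot_rot] using this
  cases c
  · rw [x12_zero, one_mul, mul_one]
    exact (congrArg (· * P.x31 d) P.x32_zero).symm ▸ (one_mul _).symm
  · exact b d
  · exact b' d
  · exact b'' d

/-- By `x31_x12` the product x₃₂(cd)·x₃₁(d) is conjugate to an involution, so its factors commute;
for fixed d ≠ 0 the products cd with c ≠ 0 exhaust the nonzero elements. -/
theorem x32_x31_comm (c d : K4) : P.x32 c * P.x31 d = P.x31 d * P.x32 c := by
  have main : ∀ c d, c ≠ K4.o → P.x32 (c.mul d) * P.x31 d = P.x31 d * P.x32 (c.mul d) := by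
    intro c d _
    apply commute_of_involutions (P.x32_mul_self _) (P.x31_mul_self _)
    rw [← x31_x12]
    exact conj_mul_self (P.x12_mul_self _) (P.x31_mul_self _)
  have ex : ∀ c d : K4, d ≠ K4.o → c ≠ K4.o → ∃ x : K4, x ≠ K4.o ∧ x.mul d = c := by
    intro c d hd hc
    cases c <;> cases d <;> first
      | exact absurd rfl hd | exact absurd rfl hc
      | exact ⟨K4.e, by decide, rfl⟩ | exact ⟨K4.a, by decide, rfl⟩
      | exact ⟨K4.b, by decide, rfl⟩
  by_cases hd : d = K4.o
  · rw [hd, x31_zero, one_mul, mul_one]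
  by_cases hc : c = K4.o
  · rw [hc, x32_zero, one_mul, mul_one]
  obtain ⟨x, hx, rfl⟩ := ex c d hd hc
  exact main x d hx

theorem x12_x13_comm (c d : K4) : P.x12 c * P.x13 d = P.x13 d * P.x12 c := by
  have := congrArg P.cT (P.x32_x31_comm c d)
  simpa only [map_mul, cT_x32, cT_x31] using this

theorem x23_x12 (c d : K4) : P.x23 c * P.x12 d * P.x23 c = P.x13 (c.mul d) * P.x12 d := by
  have := congrArg P.cT (congrArg P.cJ (P.x31_x12 c d))
  simpa only [map_mul, cJ_x12, cJ_x32, cJ_x31, cT_x21, cT_x31, cT_x32] using this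

theorem x23_mul_self (c : K4) : P.x23 c * P.x23 c = 1 := by
  rw [x23, x21, ← map_mul, ← map_mul, x12_mul_self, map_one, map_one]

theorem x13_mul_self (c : K4) : P.x13 c * P.x13 c = 1 := by
  rw [x13, ← map_mul, x31_mul_self, map_one]

theorem x23_mul_x12 (c d : K4) :
    P.x23 c * P.x12 d = P.x12 d * (P.x13 (c.mul d) * P.x23 c) := by
  have h := P.x23_x12 c d
  calc P.x23 c * P.x12 d = P.x23 c * P.x12 d * (P.x23 c * P.x23 c) := by
        rw [x23_mul_self, mul_one]
    _ = (P.x23 c * P.x12 d * P.x23 c) * P.x23 c := by group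
    _ = _ := by rw [h, ← x12_x13_comm]; group

end LinearTuple

/-! ### Bruhat decomposition of the linear group -/

namespace LinearTuple

variable {G : Type*} [Group G] (P : LinearTuple G)

/-- The Borel subgroup. -/
def borel : Subgroup G := Subgroup.closure {P.s, P.r, P.x23 K4.e}

theorem borel_le {M : Subgroup G} (hs : P.s ∈ M) (hr : P.r ∈ M) (hx : P.x23 K4.e ∈ M) :
    P.borel ≤ M := by
  rw [borel, Subgroup.closure_le]
  rintro x (rfl | rfl | rfl) <;> assumption

theorem s_mem_borel : P.s ∈ P.borel := Subgroup.subset_closure (by simp)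
theorem r_mem_borel : P.r ∈ P.borel := Subgroup.subset_closure (by simp)

theorem cR_mem {M : Subgroup G} (hr : P.r ∈ M) {x : G} (hx : x ∈ M) : P.cR x ∈ M :=
  M.mul_mem (M.mul_mem hr hx) (M.inv_mem hr)

theorem x12_mem {M : Subgroup G} (hr : P.r ∈ M) (hs : P.s ∈ M) (c : K4) : P.x12 c ∈ M := by
  cases c
  · exact M.one_mem
  · exact hs
  · exact P.cR_mem hr hs
  · exact P.cR_mem hr (P.cR_mem hr hs)

theorem x23_mem {M : Subgroup G} (hr : P.r ∈ M) (hx : P.x23 K4.e ∈ M) (c : K4) :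
    P.x23 c ∈ M := by
  have ha : P.x23 K4.a ∈ M := by
    have := P.cR_mem hr hx
    rwa [cR_x23] at this
  cases c
  · rw [x23_zero]; exact M.one_mem
  · exact hx
  · exact ha
  · have := P.cR_mem hr ha
    rwa [cR_x23] at this

theorem x13_mem {M : Subgroup G} (hr : P.r ∈ M) (hs : P.s ∈ M) (hx : P.x23 K4.e ∈ M) (c : K4) :
    P.x13 c ∈ M := by
  have h : P.x13 c = P.x23 K4.e * P.x12 c * P.x23 K4.e * P.x12 c := by
    rw [x23_x12, mul_assoc, x12_mul_self, mul_one]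
    rfl
  rw [h]
  have := P.x12_mem hr hs c
  exact M.mul_mem (M.mul_mem (M.mul_mem hx this) hx) this

theorem x12_mem_borel (c : K4) : P.x12 c ∈ P.borel := P.x12_mem P.r_mem_borel P.s_mem_borel c
theorem x23_mem_borel (c : K4) : P.x23 c ∈ P.borel :=
  P.x23_mem P.r_mem_borel (Subgroup.subset_closure (by simp)) c
theorem x13_mem_borel (c : K4) : P.x13 c ∈ P.borel :=
  P.x13_mem P.r_mem_borel P.s_mem_borel (Subgroup.subset_closure (by simp)) c

theorem r_mul_x12 (c : K4) : P.r * P.x12 c = P.x12 c.rot * P.r := by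
  rw [← cR_x12, cR_apply]; group
theorem r_mul_x23 (c : K4) : P.r * P.x23 c = P.x23 c.rot * P.r := by
  rw [← cR_x23, cR_apply]; group

theorem pow_r_mul_x12 (n : ℕ) (c : K4) : ∃ d, P.r ^ n * P.x12 c = P.x12 d * P.r ^ n := by
  induction n generalizing c with
  | zero => exact ⟨c, by simp⟩
  | succ n ih =>
    obtain ⟨d, hd⟩ := ih c.rot
    exact ⟨d, by rw [pow_succ, mul_assoc, r_mul_x12, ← mul_assoc, hd, mul_assoc]⟩
theorem pow_r_mul_x23 (n : ℕ) (c : K4) : ∃ d, P.r ^ n * P.x23 c = P.x23 d * P.r ^ n := by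
  induction n generalizing c with
  | zero => exact ⟨c, by simp⟩
  | succ n ih =>
    obtain ⟨d, hd⟩ := ih c.rot
    exact ⟨d, by rw [pow_succ, mul_assoc, r_mul_x23, ← mul_assoc, hd, mul_assoc]⟩

theorem inv_x23 (c : K4) : (P.x23 c)⁻¹ = P.x23 c := inv_eq_of_mul_eq_one_left (P.x23_mul_self c)
theorem inv_x13 (c : K4) : (P.x13 c)⁻¹ = P.x13 c := inv_eq_of_mul_eq_one_left (P.x13_mul_self c)
theorem inv_r : P.r⁻¹ = P.r ^ 2 := by rw [pow_two, r_mul_r]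

/-- Words of this shape are stable under right multiplication by the generators: powers of r only
rescale parameters, and moving x₁₂ left past x₂₃ costs a factor x₁₃, which commutes with x₁₂.
Uniqueness is not needed. -/
theorem borel_normal_form {x : G} (hx : x ∈ P.borel) :
    ∃ c d f n, x = P.x12 c * P.x13 d * P.x23 f * P.r ^ n := by
  have h12 : ∀ x, (∃ c d f n, x = P.x12 c * P.x13 d * P.x23 f * P.r ^ n) → ∀ y,
      ∃ c d f n, x * P.x12 y = P.x12 c * P.x13 d * P.x23 f * P.r ^ n := by
    rintro _ ⟨c, d, f, n, rfl⟩ y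
    obtain ⟨y', hy⟩ := P.pow_r_mul_x12 n y
    refine ⟨c.add y', d.add (f.mul y'), f, n, ?_⟩
    rw [← x12_add, ← x13_add]
    calc _ = P.x12 c * P.x13 d * P.x23 f * (P.r ^ n * P.x12 y) := by group
      _ = P.x12 c * P.x13 d * (P.x23 f * P.x12 y') * P.r ^ n := by rw [hy]; group
      _ = P.x12 c * (P.x13 d * P.x12 y') * P.x13 (f.mul y') * P.x23 f * P.r ^ n := by
        rw [x23_mul_x12]; group
      _ = _ := by rw [← x12_x13_comm]; group
  have h23 : ∀ x, (∃ c d f n, x = P.x12 c * P.x13 d * P.x23 f * P.r ^ n) → ∀ y,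
      ∃ c d f n, x * P.x23 y = P.x12 c * P.x13 d * P.x23 f * P.r ^ n := by
    rintro _ ⟨c, d, f, n, rfl⟩ y
    obtain ⟨y', hy⟩ := P.pow_r_mul_x23 n y
    refine ⟨c, d, f.add y', n, ?_⟩
    rw [← x23_add]
    calc _ = P.x12 c * P.x13 d * P.x23 f * (P.r ^ n * P.x23 y) := by group
      _ = _ := by rw [hy]; group
  have hr : ∀ x, (∃ c d f n, x = P.x12 c * P.x13 d * P.x23 f * P.r ^ n) → ∀ m,
      ∃ c d f n, x * P.r ^ m = P.x12 c * P.x13 d * P.x23 f * P.r ^ n := by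
    rintro _ ⟨c, d, f, n, rfl⟩ m
    exact ⟨c, d, f, n + m, by rw [pow_add]; group⟩
  induction hx using Subgroup.closure_induction_right with
  | one => exact ⟨K4.o, K4.o, K4.o, 0, by simp [x12_zero, x13_zero, x23_zero]⟩
  | mul_right y z _ hz ih =>
    rcases hz with rfl | rfl | rfl
    · exact h12 _ ih K4.e
    · have := hr _ ih 1
      rwa [pow_one] at this
    · exact h23 _ ih K4.e
  | mul_inv_cancel y z _ hz ih =>
    rcases hz with rfl | rfl | rfl
    · rw [inv_s]; exact h12 _ ih K4.e
    · rw [inv_r]; exact hr _ ih 2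
    · rw [inv_x23]; exact h23 _ ih K4.e

theorem x23_mul_pow_r (n : ℕ) (c : K4) : ∃ d, P.x23 c * P.r ^ n = P.r ^ n * P.x23 d := by
  induction n generalizing c with
  | zero => exact ⟨c, by simp⟩
  | succ n ih =>
    obtain ⟨d, hd⟩ := ih c.rot.rot
    refine ⟨d, ?_⟩
    have h := P.r_mul_x23 c.rot.rot
    rw [rot_rot_rot] at h
    rw [pow_succ', ← mul_assoc, ← h, mul_assoc, hd, mul_assoc]

/-- The second simple reflection. -/
def k : G := P.t * P.j * P.t

theorem k_eq : P.k = P.cT P.j := by rw [cT_apply, k]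
theorem k_mul_k : P.k * P.k = 1 := by rw [k_eq, ← map_mul, j_mul_j, map_one]

theorem k_conj (x : G) : P.k * x * P.k = P.cT (P.cJ (P.cT x)) := by
  simp only [k, cT_apply, cJ_apply, mul_assoc]

theorem k_conj_x12 (c : K4) : P.k * P.x12 c * P.k = P.x13 c := by
  rw [k_conj, cT_x12, cJ_x32, cT_x31]
theorem k_conj_x13 (c : K4) : P.k * P.x13 c * P.k = P.x12 c := by
  rw [k_conj, cT_x13, cJ_x31, cT_x32]
theorem k_conj_x23 (c : K4) : P.k * P.x23 c * P.k = P.x32 c := by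
  rw [k_conj, cT_x23, cJ_x21, cT_x12]

theorem jkj : P.j * P.k * P.j = P.k * P.j * P.k := by
  have h := P.jtj
  have e1 : ∀ y, P.j * (P.j * y) = y := fun y => by rw [← mul_assoc, P.j_mul_j, one_mul]
  have e2 : ∀ y, P.t * (P.t * y) = y := fun y => by rw [← mul_assoc, P.t_mul_t, one_mul]
  have h1 : P.j * P.k * P.j = P.t := by
    rw [k, ← h]
    simp only [mul_assoc, e1, P.j_mul_j, mul_one]
  have h2 : P.k * P.j * P.k = P.t := by
    rw [k]
    calc _ = P.t * P.j * (P.t * P.j * P.t) * P.j * P.t := by group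
      _ = P.t := by rw [← h]; simp only [mul_assoc, e1, e2, P.j_mul_j, one_mul]
  rw [h1, h2]

theorem t_eq : P.t = P.j * P.k * P.j := by
  have e1 : ∀ y, P.j * (P.j * y) = y := fun y => by rw [← mul_assoc, P.j_mul_j, one_mul]
  rw [k, ← P.jtj]
  simp only [mul_assoc, e1, P.j_mul_j, mul_one]

theorem j_eq : P.j = P.s * P.x21 K4.e * P.s := by
  have h := P.jsj
  have e : P.x21 K4.e = P.s * P.j * P.s := by rw [x21, x12_one, cJ_apply, h]
  have e1 : ∀ y, P.s * (P.s * y) = y := fun y => by rw [← mul_assoc, P.s_mul_s, one_mul]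
  rw [e]
  simp only [mul_assoc, e1, P.s_mul_s, mul_one]

/-- The identity `j_eq` carried to the indices 2, 3 by conjugation with j and t. It allows `para` to
be generated by root elements and r, on which the relations for `u` are stated. -/
theorem k_eq_x23 : P.k = P.x23 K4.e * P.x32 K4.e * P.x23 K4.e := by
  have h := congrArg P.cT (congrArg P.cJ P.j_eq)
  have hj : P.cJ P.j = P.j := by rw [cJ_apply, P.j_mul_j, one_mul]
  rw [hj, ← k_eq] at h
  rw [h, ← x12_one, map_mul, map_mul, map_mul, map_mul, cJ_x12, cJ_x21, cT_x21, cT_x12]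

/-- The rank one relation. -/
theorem cJ_x12_cell {c : K4} (hc : c ≠ K4.o) :
    ∃ d n, P.cJ (P.x12 c) = P.x12 d * (P.r ^ n * P.j) * P.x12 d := by
  have h1 : P.cJ (P.x12 K4.e) = P.x12 K4.e * (P.r ^ 0 * P.j) * P.x12 K4.e := by
    rw [cJ_apply, x12_one, jsj, pow_zero, one_mul]
  have step : ∀ c, (∃ d n, P.cJ (P.x12 c) = P.x12 d * (P.r ^ n * P.j) * P.x12 d) →
      ∃ d n, P.cJ (P.x12 c.rot.rot) = P.x12 d * (P.r ^ n * P.j) * P.x12 d := by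
    rintro c ⟨d, n, h⟩
    -- Conjugation by r turns j into jr = r⁻¹j = r²j, hence the exponent n + 2.
    refine ⟨d.rot, n + 2, ?_⟩
    have := congrArg P.cR h
    rw [cR_cJ, cR_x12, cR_x12] at this
    rw [this, map_mul, map_mul, map_mul, map_pow, cR_x12, cR_j, j_mul_r, inv_r, pow_add]
    have hr : P.cR P.r = P.r := by rw [cR_apply]; group
    rw [hr]
    simp only [mul_assoc]
  cases c
  · exact absurd rfl hc
  · exact ⟨_, _, h1⟩
  · exact step _ (step _ ⟨_, _, h1⟩)
  · exact step _ ⟨_, _, h1⟩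

theorem k_x23_k_cell {c : K4} (hc : c ≠ K4.o) :
    ∃ d n, P.k * P.x23 c * P.k = P.x23 d * (P.r ^ n * P.k) * P.x23 d := by
  obtain ⟨d, n, h⟩ := P.cJ_x12_cell hc
  have h' := congrArg P.cT (congrArg P.cJ h)
  have hj : P.cJ P.j = P.j := by rw [cJ_apply, P.j_mul_j, one_mul]
  refine ⟨d, n, ?_⟩
  rw [k_conj_x23]
  simpa only [map_mul, map_pow, cJ_x12, cJ_x21, cT_x12, cT_x21, cJ_r, map_inv, cT_r, inv_inv, hj,
    ← k_eq] using h'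

theorem k_conj_pow_r (n : ℕ) : P.k * P.r ^ n * P.k = (P.r ^ n)⁻¹ := by
  rw [k_conj, map_pow, map_pow, map_pow, cT_r, map_inv, cJ_r, inv_inv, cT_r, inv_pow]

/-- The stabiliser of a point. -/
def para : Subgroup G := P.borel ⊔ Subgroup.zpowers P.k

theorem borel_le_para : P.borel ≤ P.para := le_sup_left
theorem k_mem_para : P.k ∈ P.para :=
  (le_sup_right : _ ≤ P.para) (Subgroup.mem_zpowers P.k)

theorem conj_mul {g : G} (hg : g * g = 1) (x y : G) :
    g * (x * y) * g = (g * x * g) * (g * y * g) := by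
  have e : ∀ y, g * (g * y) = y := fun y => by rw [← mul_assoc, hg, one_mul]
  simp only [mul_assoc, e]

/-- k swaps x₁₂ with x₁₃ and inverts r, so only the factor x₂₃(f) can leave `borel`; for f ≠ 0 the
rank one relation puts it in the double coset of k. -/
theorem inCells_k_conj : ∀ x ∈ P.borel, InCells P.borel P.k (P.k * x * P.k) := by
  intro x hx
  obtain ⟨c, d, f, n, rfl⟩ := P.borel_normal_form hx
  have hr : (P.r ^ n)⁻¹ ∈ P.borel := P.borel.inv_mem (P.borel.pow_mem P.r_mem_borel n)
  rw [conj_mul P.k_mul_k, conj_mul P.k_mul_k, conj_mul P.k_mul_k, k_conj_x12, k_conj_x13,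
    k_conj_pow_r]
  have hcd := P.borel.mul_mem (P.x13_mem_borel c) (P.x12_mem_borel d)
  by_cases hf : f = K4.o
  · left
    rw [hf, x23_zero, mul_one, P.k_mul_k, mul_one]
    exact P.borel.mul_mem hcd hr
  · right
    obtain ⟨y, m, h⟩ := P.k_x23_k_cell hf
    refine ⟨P.x13 c * P.x12 d * (P.x23 y * P.r ^ m), ?_, P.x23 y * (P.r ^ n)⁻¹, ?_, ?_⟩
    · exact P.borel.mul_mem hcd (P.borel.mul_mem (P.x23_mem_borel y)
        (P.borel.pow_mem P.r_mem_borel m))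
    · exact P.borel.mul_mem (P.x23_mem_borel y) hr
    · rw [h]; simp only [mul_assoc]

theorem para_cells {x : G} (hx : x ∈ P.para) : InCells P.borel P.k x :=
  inCells_of_mem_sup P.k_mul_k P.inCells_k_conj hx

theorem r_mem_para : P.r ∈ P.para := P.borel_le_para P.r_mem_borel
theorem x12_mem_para (c : K4) : P.x12 c ∈ P.para := P.borel_le_para (P.x12_mem_borel c)
theorem x13_mem_para (c : K4) : P.x13 c ∈ P.para := P.borel_le_para (P.x13_mem_borel c)
theorem x23_mem_para (c : K4) : P.x23 c ∈ P.para := P.borel_le_para (P.x23_mem_borel c)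
theorem x32_mem_para (c : K4) : P.x32 c ∈ P.para := by
  rw [← k_conj_x23]
  exact P.para.mul_mem (P.para.mul_mem P.k_mem_para (P.x23_mem_para c)) P.k_mem_para

theorem para_le {M : Subgroup G} (hs : P.s ∈ M) (hr : P.r ∈ M) (hx : P.x23 K4.e ∈ M)
    (hy : P.x32 K4.e ∈ M) : P.para ≤ M := by
  refine sup_le (P.borel_le hs hr hx) ?_
  rw [Subgroup.zpowers_le, k_eq_x23]
  exact M.mul_mem (M.mul_mem hx hy) hx

theorem inCells_j_conj : ∀ x ∈ P.para, InCells P.para P.j (P.j * x * P.j) := by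
  have hB : ∀ n c d f,
      P.j * (P.x12 c * P.x13 d * P.x23 f * P.r ^ n) * P.j =
        P.cJ (P.x12 c) * (P.x23 d * P.x13 f * (P.r ^ n)⁻¹) := by
    intro n c d f
    rw [← cJ_apply, map_mul, map_mul, map_mul, cJ_x13, cJ_x23, map_pow, cJ_r, inv_pow]
    simp only [mul_assoc]
  have hQ : ∀ n d f, P.x23 d * P.x13 f * (P.r ^ n)⁻¹ ∈ P.para := fun n d f =>
    P.para.mul_mem (P.para.mul_mem (P.x23_mem_para d) (P.x13_mem_para f))
      (P.para.inv_mem (P.para.pow_mem P.r_mem_para n))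
  intro x hx
  rcases P.para_cells hx with hx | ⟨y, hy, z, hz, rfl⟩
  · obtain ⟨c, d, f, n, rfl⟩ := P.borel_normal_form hx
    rw [hB]
    by_cases hc : c = K4.o
    · left
      rw [hc, x12_zero, map_one, one_mul]
      exact hQ _ _ _
    · right
      obtain ⟨y, m, h⟩ := P.cJ_x12_cell hc
      refine ⟨P.x12 y * P.r ^ m, ?_, P.x12 y * (P.x23 d * P.x13 f * (P.r ^ n)⁻¹), ?_, ?_⟩
      · exact P.para.mul_mem (P.x12_mem_para y) (P.para.pow_mem P.r_mem_para m)
      · exact P.para.mul_mem (P.x12_mem_para y) (hQ _ _ _)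
      · rw [h]; simp only [mul_assoc]
  · right
    obtain ⟨c, d, f, n, rfl⟩ := P.borel_normal_form hz
    obtain ⟨g, hg⟩ := P.x23_mul_pow_r n f
    have ek : ∀ y, P.k * (P.k * y) = y := fun y => by rw [← mul_assoc, P.k_mul_k, one_mul]
    -- In the cell of k, all of z except its x₂₃ factor passes leftwards through k into `borel`.
    set y' := y * (P.k * (P.x12 c * P.x13 d * P.r ^ n) * P.k) with hy'
    have hyz : y * P.k * (P.x12 c * P.x13 d * P.x23 f * P.r ^ n) = y' * P.k * P.x23 g := by
      rw [hy', mul_assoc _ (P.x23 f), hg]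
      simp only [mul_assoc, ek]
    have hyb : y' ∈ P.borel := by
      rw [hy', conj_mul P.k_mul_k, conj_mul P.k_mul_k, k_conj_x12, k_conj_x13, k_conj_pow_r]
      exact P.borel.mul_mem hy (P.borel.mul_mem (P.borel.mul_mem (P.x13_mem_borel c)
        (P.x12_mem_borel d)) (P.borel.inv_mem (P.borel.pow_mem P.r_mem_borel n)))
    rw [hyz]
    -- The normal form of the inverse places x₁₂ last in y', adjacent to k, where it becomes x₁₃ on
    -- the other side. The remaining factors other than k are mapped into `para` by j, and jkj = kjk
    -- supplies the single j.
    obtain ⟨c', d', f', n', hinv⟩ := P.borel_normal_form (P.borel.inv_mem hyb)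
    have hform : y' = (P.r ^ n')⁻¹ * P.x23 f' * P.x13 d' * P.x12 c' := by
      rw [← inv_inv y', hinv]
      simp only [mul_inv_rev, inv_x12, inv_x23, inv_x13, mul_assoc]
    have hx12 : P.x12 c' * P.k = P.k * P.x13 c' := by
      rw [← k_conj_x12, mul_assoc, ek]
    have hjk : P.cJ P.k = P.k * P.j * P.k := by rw [cJ_apply, jkj]
    refine ⟨P.cJ ((P.r ^ n')⁻¹ * P.x23 f' * P.x13 d') * P.k, ?_,
      P.k * (P.x23 c' * P.x13 g), ?_, ?_⟩
    · rw [map_mul, map_mul, map_inv, map_pow, cJ_r, cJ_x23, cJ_x13]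
      exact P.para.mul_mem (P.para.mul_mem (P.para.mul_mem (P.para.inv_mem
        (P.para.pow_mem (P.para.inv_mem P.r_mem_para) _)) (P.x13_mem_para _))
        (P.x23_mem_para _)) P.k_mem_para
    · exact P.para.mul_mem P.k_mem_para (P.para.mul_mem (P.x23_mem_para _) (P.x13_mem_para _))
    · rw [← cJ_apply, hform, mul_assoc _ (P.x12 c'), hx12, mul_assoc _ (P.k * P.x13 c'),
        map_mul, mul_assoc P.k, map_mul P.cJ P.k, map_mul P.cJ (P.x13 c'), hjk, cJ_x13, cJ_x23]
      simp only [mul_assoc]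

/-- The subgroup generated by the linear elements. -/
def linear : Subgroup G := P.para ⊔ Subgroup.zpowers P.j

theorem para_le_linear : P.para ≤ P.linear := le_sup_left
theorem j_mem_linear : P.j ∈ P.linear :=
  (le_sup_right : _ ≤ P.linear) (Subgroup.mem_zpowers P.j)
theorem s_mem_linear : P.s ∈ P.linear := P.para_le_linear (P.x12_mem_para K4.e)
theorem r_mem_linear : P.r ∈ P.linear := P.para_le_linear P.r_mem_para
theorem t_mem_linear : P.t ∈ P.linear := by
  rw [t_eq]
  exact P.linear.mul_mem (P.linear.mul_mem P.j_mem_linear (P.para_le_linear P.k_mem_para))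
    P.j_mem_linear

theorem linear_cells {x : G} (hx : x ∈ P.linear) : InCells P.para P.j x :=
  inCells_of_mem_sup P.j_mul_j P.inCells_j_conj hx

theorem linear_le {M : Subgroup G} (hs : P.s ∈ M) (hr : P.r ∈ M) (hj : P.j ∈ M)
    (hx : P.x23 K4.e ∈ M) (hy : P.x32 K4.e ∈ M) : P.linear ≤ M :=
  sup_le (P.para_le hs hr hx hy) (by rwa [Subgroup.zpowers_le])

end LinearTuple

/-! ### The relations of the Mathieu groups -/

/-- Elements of a group that satisfy the relations of `M₂₄`. -/
structure MathieuTuple (G : Type*) [Group G] extends LinearTuple G where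
  u : G
  v : G
  w : G
  u_sq : u ^ 2 = 1
  us_sq : (u * s) ^ 2 = 1
  uj_cube : (u * j) ^ 3 = 1
  ru : cj r u = cj r j
  stu : cj s (t * u) = s * cj s t
  sjtu : cj s (j * t * u) = cj s (j * t) * cj s (t * j * t)
  v_sq : v ^ 2 = 1
  vs_sq : (v * s) ^ 2 = 1
  vu_cube : (v * u) ^ 3 = 1
  vj_sq : (v * j) ^ 2 = 1
  vr_sq : (v * r) ^ 2 = 1
  stv : cj s (t * v) = cj s (t * r)
  sjtv : cj s (j * t * v) = cj s (j * t * r)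
  w_sq : w ^ 2 = 1
  wr_sq : (w * r) ^ 2 = 1
  ws_sq : (w * s) ^ 2 = 1
  wj_sq : (w * j) ^ 2 = 1
  wu_sq : (w * u) ^ 2 = 1
  wst_sq : (w * cj s t) ^ 2 = 1
  wsjt_sq : (w * cj s (j * t)) ^ 2 = 1
  wv_cube : (w * v) ^ 3 = 1

section

variable {G : Type*} [Group G]

theorem conj_eq_inv_of_sq {x y : G} (h : (x * y) ^ 2 = 1) : x * y * x = y⁻¹ := by
  rw [pow_two] at h
  exact eq_inv_of_mul_eq_one_left (by rw [← h]; group)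

theorem braid_of_cube {x y : G} (hx : x * x = 1) (hy : y * y = 1) (h : (x * y) ^ 3 = 1) :
    x * y * x = y * x * y := by
  have hx' : x⁻¹ = x := inv_eq_of_mul_eq_one_left hx
  have hy' : y⁻¹ = y := inv_eq_of_mul_eq_one_left hy
  have h1 : x * y * x * (y * x * y) = 1 := by
    rw [← h, pow_succ, pow_two]; simp only [mul_assoc]
  rw [eq_inv_of_mul_eq_one_left h1]
  simp only [mul_inv_rev, hx', hy', mul_assoc]

end

namespace MathieuTuple

variable {G : Type*} [Group G] (P : MathieuTuple G)

theorem u_mul_u : P.u * P.u = 1 := by rw [← pow_two, P.u_sq]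
theorem v_mul_v : P.v * P.v = 1 := by rw [← pow_two, P.v_sq]
theorem w_mul_w : P.w * P.w = 1 := by rw [← pow_two, P.w_sq]
theorem inv_u : P.u⁻¹ = P.u := inv_eq_of_mul_eq_one_left P.u_mul_u
theorem inv_v : P.v⁻¹ = P.v := inv_eq_of_mul_eq_one_left P.v_mul_v

theorem cj_t : cj P.s P.t = P.x32 K4.e := by
  rw [LinearTuple.x32, LinearTuple.cT_apply, LinearTuple.x12_one, cj, P.inv_t]
theorem cj_jt : cj P.s (P.j * P.t) = P.x23 K4.e := by
  rw [LinearTuple.x23, LinearTuple.x21, LinearTuple.cT_apply, LinearTuple.cJ_apply,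
    LinearTuple.x12_one, cj, mul_inv_rev, P.inv_j, P.inv_t]
  simp only [mul_assoc]
theorem cj_tjt : cj P.s (P.t * P.j * P.t) = P.x13 K4.e := by
  rw [LinearTuple.x13, LinearTuple.x31, LinearTuple.x32, LinearTuple.cT_apply,
    LinearTuple.cJ_apply, LinearTuple.cT_apply, LinearTuple.x12_one, cj, mul_inv_rev, mul_inv_rev,
    P.inv_j, P.inv_t]
  simp only [mul_assoc]
theorem cj_mul (x y z : G) : cj x (y * z) = cj (cj x y) z := by
  simp only [cj, mul_inv_rev, mul_assoc]

/-- A subgroup is normalised by an involution that maps generators into it. -/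
theorem conj_mem_of_le {H M : Subgroup G} {g : G} (hg : g * g = 1)
    (h : H ≤ M.comap (MulAut.conj g).toMonoidHom) {x : G} (hx : x ∈ H) : g * x * g ∈ M := by
  have := h hx
  rw [Subgroup.mem_comap] at this
  have e : g⁻¹ = g := inv_eq_of_mul_eq_one_left hg
  simpa [MulAut.conj_apply, e] using this

theorem mem_comap_conj {M : Subgroup G} {g x : G} (hg : g * g = 1) (h : g * x * g ∈ M) :
    x ∈ M.comap (MulAut.conj g).toMonoidHom := by
  have e : g⁻¹ = g := inv_eq_of_mul_eq_one_left hg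
  rw [Subgroup.mem_comap]
  simpa [MulAut.conj_apply, e] using h

/-- The subgroup generated by the linear elements and `u`. -/
def deg22 : Subgroup G := P.linear ⊔ Subgroup.zpowers P.u
/-- The subgroup generated by the linear elements, `u` and `v`. -/
def deg23 : Subgroup G := P.deg22 ⊔ Subgroup.zpowers P.v
/-- The subgroup generated by all the elements. -/
def deg24 : Subgroup G := P.deg23 ⊔ Subgroup.zpowers P.w

theorem linear_le_deg22 : P.linear ≤ P.deg22 := le_sup_left
theorem deg22_le_deg23 : P.deg22 ≤ P.deg23 := le_sup_left
theorem deg23_le_deg24 : P.deg23 ≤ P.deg24 := le_sup_left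
theorem u_mem_deg22 : P.u ∈ P.deg22 :=
  (le_sup_right : _ ≤ P.deg22) (Subgroup.mem_zpowers P.u)
theorem v_mem_deg23 : P.v ∈ P.deg23 :=
  (le_sup_right : _ ≤ P.deg23) (Subgroup.mem_zpowers P.v)
theorem w_mem_deg24 : P.w ∈ P.deg24 :=
  (le_sup_right : _ ≤ P.deg24) (Subgroup.mem_zpowers P.w)

/-- The relations (us)² = 1, rᵘ = rʲ and the two relations for conjugates of s give the images under
u of the four generators s, r, x₂₃(1), x₃₂(1) used in `para_le`. -/
theorem u_conj_para {x : G} (hx : x ∈ P.para) : P.u * x * P.u ∈ P.para := by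
  refine conj_mem_of_le P.u_mul_u (P.para_le ?_ ?_ ?_ ?_) hx <;>
    refine mem_comap_conj P.u_mul_u ?_
  · rw [conj_eq_inv_of_sq P.us_sq]
    exact P.para.inv_mem (P.x12_mem_para K4.e)
  · have h := P.ru
    rw [cj, cj, P.inv_u, P.inv_j, ← P.cJ_apply, P.cJ_r] at h
    rw [h]
    exact P.para.inv_mem P.r_mem_para
  · have h := P.sjtu
    rw [cj_mul, cj_jt, cj_tjt, cj, P.inv_u] at h
    rw [h]
    exact P.para.mul_mem (P.x23_mem_para _) (P.x13_mem_para _)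
  · have h := P.stu
    rw [cj_mul, cj_t, cj, P.inv_u] at h
    rw [h]
    exact P.para.mul_mem (P.x12_mem_para K4.e) (P.x32_mem_para _)

/-- The first of three uses of the braid argument, with pairs (u, j), (v, u), (w, v): each new
involution normalises the group two steps below. -/
theorem deg22_cells {x : G} (hx : x ∈ P.deg22) : InCells P.linear P.u x :=
  inCells_of_mem_sup P.u_mul_u
    (inCells_conj_of_braid P.para_le_linear P.j_mem_linear P.u_mul_u
      (fun _ => P.linear_cells) (fun _ => P.u_conj_para)
      (braid_of_cube P.u_mul_u P.j_mul_j P.uj_cube)) hx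

theorem v_conj_linear {x : G} (hx : x ∈ P.linear) : P.v * x * P.v ∈ P.linear := by
  have hr := P.r_mem_linear
  refine conj_mem_of_le P.v_mul_v (P.linear_le ?_ ?_ ?_ ?_ ?_) hx <;>
    refine mem_comap_conj P.v_mul_v ?_
  · rw [conj_eq_inv_of_sq P.vs_sq]
    exact P.linear.inv_mem P.s_mem_linear
  · rw [conj_eq_inv_of_sq P.vr_sq]
    exact P.linear.inv_mem hr
  · rw [conj_eq_inv_of_sq P.vj_sq]
    exact P.linear.inv_mem P.j_mem_linear
  · have h := P.sjtv
    rw [cj_mul, cj_mul _ _ P.r, cj_jt, cj, P.inv_v] at h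
    rw [h]
    exact P.linear.mul_mem (P.linear.mul_mem (P.linear.inv_mem hr)
      (P.para_le_linear (P.x23_mem_para _))) hr
  · have h := P.stv
    rw [cj_mul, cj_mul _ _ P.r, cj_t, cj, P.inv_v] at h
    rw [h]
    exact P.linear.mul_mem (P.linear.mul_mem (P.linear.inv_mem hr)
      (P.para_le_linear (P.x32_mem_para _))) hr

theorem deg23_cells {x : G} (hx : x ∈ P.deg23) : InCells P.deg22 P.v x :=
  inCells_of_mem_sup P.v_mul_v
    (inCells_conj_of_braid P.linear_le_deg22 P.u_mem_deg22 P.v_mul_v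
      (fun _ => P.deg22_cells) (fun _ => P.v_conj_linear)
      (braid_of_cube P.v_mul_v P.u_mul_u P.vu_cube)) hx

theorem w_conj_deg22 {x : G} (hx : x ∈ P.deg22) : P.w * x * P.w ∈ P.deg22 := by
  have key : ∀ y, (P.w * y) ^ 2 = 1 → y ∈ P.deg22 →
      y ∈ P.deg22.comap (MulAut.conj P.w).toMonoidHom := fun y h hy => by
    refine mem_comap_conj P.w_mul_w ?_
    rw [conj_eq_inv_of_sq h]
    exact P.deg22.inv_mem hy
  refine conj_mem_of_le P.w_mul_w (sup_le (P.linear_le ?_ ?_ ?_ ?_ ?_) ?_) hx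
  · exact key _ P.ws_sq (P.linear_le_deg22 P.s_mem_linear)
  · exact key _ P.wr_sq (P.linear_le_deg22 P.r_mem_linear)
  · exact key _ P.wj_sq (P.linear_le_deg22 P.j_mem_linear)
  · refine key _ ?_ (P.linear_le_deg22 (P.para_le_linear (P.x23_mem_para _)))
    rw [← cj_jt, P.wsjt_sq]
  · refine key _ ?_ (P.linear_le_deg22 (P.para_le_linear (P.x32_mem_para _)))
    rw [← cj_t, P.wst_sq]
  · rw [Subgroup.zpowers_le]
    exact key _ P.wu_sq P.u_mem_deg22

theorem deg24_cells {x : G} (hx : x ∈ P.deg24) : InCells P.deg23 P.w x :=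
  inCells_of_mem_sup P.w_mul_w
    (inCells_conj_of_braid P.deg22_le_deg23 P.v_mem_deg23 P.w_mul_w
      (fun _ => P.deg23_cells) (fun _ => P.w_conj_deg22)
      (braid_of_cube P.w_mul_w P.v_mul_v P.wv_cube)) hx

end MathieuTuple

/-! ### Coordinates for the 24 points -/

namespace K4

instance : Fintype K4 := ⟨{o, e, a, b}, by intro x; cases x <;> decide⟩

/-- The element of `GF(4)` named by a symbol, for a primitive element `ζ`. -/
def toF (ζ : F4ˣ) : K4 → F4
  | o => 0
  | e => 1
  | a => ζ
  | b => ζ ^ 2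

/-- The symbols in the order `0, 1, ζ, ζ²`, continued periodically. -/
def digit (n : ℕ) : K4 :=
  match n % 4 with
  | 0 => o
  | 1 => e
  | 2 => a
  | _ => b

end K4

/-! ### Identification of the symbols with GF(4) -/

section Primitive

variable {ζ : F4ˣ} (hζ : ∀ x : F4ˣ, x ∈ Subgroup.zpowers ζ)

theorem two_eq_zero : (2 : F4) = 0 := CharTwo.two_eq_zero

include hζ in
theorem primitive_ne_one : ζ ≠ 1 := by
  rintro rfl
  have h : Nat.card F4 = 4 := by simpa using GaloisField.card 2 2 (by norm_num)
  have h2 := Nat.card_units F4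
  have : Subsingleton F4ˣ := ⟨fun x y => by
    have hx := hζ x
    have hy := hζ y
    simp only [Subgroup.zpowers_one_eq_bot, Subgroup.mem_bot] at hx hy
    rw [hx, hy]⟩
  rw [h, Nat.card_of_subsingleton (1 : F4ˣ)] at h2
  norm_num at h2

include hζ in
theorem primitive_sq : (ζ : F4) ^ 2 = 1 + ζ := by
  have h1 : (ζ : F4) - 1 ≠ 0 := by
    rw [sub_ne_zero]
    exact fun h => primitive_ne_one hζ (Units.ext h)
  have h2 : ((ζ : F4) - 1) * ((ζ : F4) ^ 2 + ζ + 1) = 0 := by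
    linear_combination unit_pow_three ζ
  have h3 := (mul_eq_zero.1 h2).resolve_left h1
  linear_combination h3 - (1 + (ζ : F4)) * two_eq_zero

include hζ in
theorem toF_surjective : Function.Surjective (K4.toF ζ) := by
  intro x
  by_cases hx : x = 0
  · exact ⟨K4.o, hx.symm⟩
  obtain ⟨n, hn⟩ := hζ (Units.mk0 x hx)
  have h3 : ζ ^ (3 : ℤ) = 1 := by
    rw [show (3 : ℤ) = (3 : ℕ) from rfl, zpow_natCast]
    exact Units.ext (by rw [Units.val_pow_eq_pow_val, unit_pow_three, Units.val_one])
  have hx' : x = ((ζ ^ n : F4ˣ) : F4) := (congrArg Units.val hn).symm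
  have hm : ζ ^ n = ζ ^ (n % 3) := by
    conv_lhs => rw [← Int.emod_add_mul_ediv n 3]
    rw [zpow_add, zpow_mul, h3, one_zpow, mul_one]
  rw [hx', hm]
  have h0 := Int.emod_nonneg n (by norm_num : (3 : ℤ) ≠ 0)
  have h4 := Int.emod_lt_of_pos n (by norm_num : (0 : ℤ) < 3)
  generalize n % 3 = m at h0 h4
  interval_cases m
  · exact ⟨K4.e, by simp [K4.toF]⟩
  · exact ⟨K4.a, by simp [K4.toF]⟩
  · exact ⟨K4.b, by simp only [K4.toF]; norm_cast⟩

theorem toF_rot (x : K4) : K4.toF ζ x.rot = ζ * K4.toF ζ x := by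
  cases x <;> simp only [K4.rot, K4.toF]
  · ring
  · ring
  · ring
  · linear_combination -unit_pow_three ζ

theorem toF_mul (x y : K4) : K4.toF ζ (x.mul y) = K4.toF ζ x * K4.toF ζ y := by
  cases x <;> simp only [K4.mul, toF_rot] <;> simp only [K4.toF] <;> ring

include hζ in
theorem toF_add (x y : K4) : K4.toF ζ (x.add y) = K4.toF ζ x + K4.toF ζ y := by
  have h := primitive_sq hζ
  have h2 := two_eq_zero
  cases x <;> cases y <;> simp only [K4.add, K4.toF] <;>
    first
      | ring1
      | linear_combination h
      | linear_combination -h2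
      | linear_combination -h - h2
      | linear_combination -(ζ : F4) * h2
      | linear_combination -h - (ζ : F4) * h2
      | linear_combination -(ζ : F4) ^ 2 * h2

theorem toF_eq_zero {x : K4} : K4.toF ζ x = 0 ↔ x = K4.o := by
  cases x <;> simp [K4.toF]

end Primitive

/-- Coordinate vectors over the computable field. -/
abbrev Vec : Type := K4 × K4 × K4

/-- The coordinate vector over `GF(4)`. -/
def vec (ζ : F4ˣ) (x : Vec) : Fin 3 → F4 := ![K4.toF ζ x.1, K4.toF ζ x.2.1, K4.toF ζ x.2.2]

/-- Scalar multiplication. -/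
def smulVec (c : K4) (x : Vec) : Vec := (c.mul x.1, c.mul x.2.1, c.mul x.2.2)

theorem vec_smulVec (ζ : F4ˣ) (c : K4) (x : Vec) :
    vec ζ (smulVec c x) = K4.toF ζ c • vec ζ x := by
  ext i; fin_cases i <;> simp [vec, smulVec, toF_mul]

theorem vec_eq_zero {ζ : F4ˣ} {x : Vec} : vec ζ x = 0 ↔ x = (K4.o, K4.o, K4.o) := by
  obtain ⟨x₀, x₁, x₂⟩ := x
  simp only [funext_iff, vec, Prod.mk.injEq]
  rw [Fin.forall_fin_succ, Fin.forall_fin_succ, Fin.forall_fin_one]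
  simp [toF_eq_zero]

open Classical in
/-- The point of the plane with given coordinates (arbitrary for the zero vector). -/
def planePt (ζ : F4ˣ) (x : Vec) : Plane :=
  if h : vec ζ x = 0 then q2 else Projectivization.mk F4 (vec ζ x) h

theorem planePt_of_ne {ζ : F4ˣ} {x : Vec} (h : vec ζ x ≠ 0) :
    planePt ζ x = Projectivization.mk F4 (vec ζ x) h := dif_neg h

theorem planePt_smulVec {ζ : F4ˣ} {c : K4} {x : Vec} (hc : c ≠ K4.o) :
    planePt ζ (smulVec c x) = planePt ζ x := by
  have hc' : K4.toF ζ c ≠ 0 := fun h => hc (toF_eq_zero.1 h)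
  by_cases h : vec ζ x = 0
  · rw [planePt, planePt, dif_pos h, dif_pos (by rw [vec_smulVec, h, smul_zero])]
  · have h' : vec ζ (smulVec c x) ≠ 0 := by
      rw [vec_smulVec]; exact smul_ne_zero hc' h
    rw [planePt_of_ne h, planePt_of_ne h', Projectivization.mk_eq_mk_iff']
    exact ⟨K4.toF ζ c, (vec_smulVec ζ c x).symm⟩

/-- Normalised coordinates of the points of the plane. -/
def coords (n : Fin 24) : Vec :=
  if n.val < 16 then (K4.e, K4.digit (n.val / 4), K4.digit n.val)
  else if n.val < 20 then (K4.o, K4.e, K4.digit n.val)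
  -- This branch is [0,0,1] for n = 20 and a nonzero dummy value for 21, 22, 23, which number u, v,
  -- w. Since `digit` reduces modulo 4, n = 16, …, 19 run through [0,1,z].
  else (K4.o, K4.o, K4.e)

/-- The 24 points, numbered. -/
def pt (ζ : F4ˣ) (n : Fin 24) : Point24 :=
  if n.val < 21 then Sum.inl (planePt ζ (coords n))
  else if n.val = 21 then Sum.inr NewPoint.u
  else if n.val = 22 then Sum.inr NewPoint.v
  else Sum.inr NewPoint.w

theorem coords_ne (n : Fin 24) : coords n ≠ (K4.o, K4.o, K4.o) := by
  revert n; decide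

theorem exists_coords : ∀ x : Vec, x ≠ (K4.o, K4.o, K4.o) →
    ∃ n : Fin 24, n.val < 21 ∧ ∃ c : K4, c ≠ K4.o ∧ x = smulVec c (coords n) := by
  decide +kernel

theorem pt_surjective {ζ : F4ˣ} (hζ : ∀ x : F4ˣ, x ∈ Subgroup.zpowers ζ) :
    Function.Surjective (pt ζ) := by
  rintro (p | p)
  · induction p using Projectivization.ind with
    | _ v hv =>
      obtain ⟨x₀, ha⟩ := toF_surjective hζ (v 0)
      obtain ⟨x₁, hb⟩ := toF_surjective hζ (v 1)
      obtain ⟨x₂, hc⟩ := toF_surjective hζ (v 2)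
      have hx : vec ζ (x₀, x₁, x₂) = v := by
        ext i; fin_cases i <;> simp [vec, ha, hb, hc]
      subst hx
      obtain ⟨n, hn, c', hc', h⟩ := exists_coords (x₀, x₁, x₂) (fun h => hv (vec_eq_zero.2 h))
      refine ⟨n, ?_⟩
      rw [pt, if_pos hn, ← planePt_of_ne hv, h, planePt_smulVec hc']
  · cases p
    · exact ⟨21, rfl⟩
    · exact ⟨22, rfl⟩
    · exact ⟨23, rfl⟩

/-- The numbered permutations. -/
def genTable : Gen → Fin 24 → Fin 24
  | Gen.s => ![0, 1, 2, 3, 16, 17, 18, 19, 12, 14, 15, 13, 8, 11, 9, 10, 4, 5, 6, 7, 20, 21, 22, 23]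
  | Gen.j => ![16, 17, 18, 19, 4, 5, 6, 7, 12, 15, 13, 14, 8, 10, 11, 9, 0, 1, 2, 3, 20, 21, 22, 23]
  | Gen.t => ![20, 1, 3, 2, 17, 5, 15, 10, 19, 9, 7, 14, 18, 13, 11, 6, 16, 4, 12, 8, 0, 21, 22, 23]
  | Gen.r => ![0, 2, 3, 1, 12, 14, 15, 13, 4, 6, 7, 5, 8, 10, 11, 9, 16, 19, 17, 18, 20, 21, 22, 23]
  | Gen.u => ![21, 1, 3, 2, 4, 17, 9, 13, 12, 6, 10, 19, 8, 7, 18, 15, 16, 5, 14, 11, 20, 0, 22, 23]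
  | Gen.v => ![0, 2, 1, 3, 4, 6, 5, 7, 12, 14, 13, 15, 8, 10, 9, 11, 16, 18, 17, 19, 20, 22, 21, 23]
  | Gen.w => ![0, 1, 3, 2, 4, 5, 7, 6, 12, 13, 15, 14, 8, 9, 11, 10, 16, 17, 19, 18, 20, 21, 23, 22]

theorem genTable_cube (n : Fin 24) :
    genTable Gen.r (genTable Gen.r (genTable Gen.r n)) = n := by
  revert n; decide

theorem genTable_sq {g : Gen} (hg : g ≠ Gen.r) (n : Fin 24) : genTable g (genTable g n) = n := by
  revert n
  cases g
  case r => exact absurd rfl hg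
  all_goals decide

/-- The numbered permutations as elements of the symmetric group. -/
def genModel (g : Gen) : Equiv.Perm (Fin 24) where
  toFun := genTable g
  invFun := match g with
    | Gen.r => fun n => genTable Gen.r (genTable Gen.r n)
    | g => genTable g
  left_inv := by
    cases g
    case r => exact genTable_cube
    all_goals exact genTable_sq (fun h => by cases h)
  right_inv := by
    cases g
    case r => exact genTable_cube
    all_goals exact genTable_sq (fun h => by cases h)

theorem rels_genModel : ∀ x ∈ relsM24, FreeGroup.lift genModel x = 1 := by
  rintro x (((h | h) | h) | h)
  · simp only [relsPSL34, Set.mem_insert_iff, Set.mem_singleton_iff] at h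
    rcases h with rfl | rfl | rfl | rfl | rfl | rfl | rfl | rfl | rfl | rfl | rfl <;>
    · simp only [map_mul, map_pow, map_inv, s, j, t, r, FreeGroup.lift_apply_of]
      refine Equiv.ext ?_
      decide +kernel
  · simp only [relsU, Set.mem_insert_iff, Set.mem_singleton_iff] at h
    rcases h with rfl | rfl | rfl | rfl | rfl | rfl <;>
    · simp only [map_mul, map_pow, map_inv, cj, s, j, t, r, u, FreeGroup.lift_apply_of]
      refine Equiv.ext ?_
      decide +kernel
  · simp only [relsV, Set.mem_insert_iff, Set.mem_singleton_iff] at h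
    rcases h with rfl | rfl | rfl | rfl | rfl | rfl | rfl <;>
    · simp only [map_mul, map_pow, map_inv, cj, s, j, t, r, u, v, FreeGroup.lift_apply_of]
      refine Equiv.ext ?_
      decide +kernel
  · simp only [relsW, Set.mem_insert_iff, Set.mem_singleton_iff] at h
    rcases h with rfl | rfl | rfl | rfl | rfl | rfl | rfl | rfl <;>
    · simp only [map_mul, map_pow, map_inv, cj, s, j, t, r, u, v, w, FreeGroup.lift_apply_of]
      refine Equiv.ext ?_
      decide +kernel

/-- The generating permutations in coordinates. -/
def genCoord : Gen → Vec → Vec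
  | Gen.s, (x, y, z) => (x.add y, y, z)
  | Gen.j, (x, y, z) => (y, x, z)
  | Gen.t, (x, y, z) => (z, y, x)
  | Gen.r, (x, y, z) => (x.rot, y, z.rot.rot)
  | Gen.u, (x, y, z) => ((x.mul x).add (y.mul z), y.mul y, z.mul z)
  | Gen.v, (x, y, z) => (x.mul x, y.mul y, (z.mul z).rot)
  | Gen.w, (x, y, z) => (x.mul x, y.mul y, z.mul z)

/-- The finite check tying the tables to the coordinate formulas; c is the scalar lost in
normalising. The second bound excludes the point [1,0,0] under `Gen.u`, which leaves the plane. -/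
theorem genCoord_coords (g : Gen) (n : Fin 24) (hn : n.val < 21) (h : (genTable g n).val < 21) :
    ∃ c : K4, c ≠ K4.o ∧ genCoord g (coords n) = smulVec c (coords (genTable g n)) := by
  revert n
  cases g <;> decide +kernel

theorem map_planePt {ζ : F4ˣ} {σ : Equiv.Perm Plane} {f : (Fin 3 → F4) → Fin 3 → F4}
    (hσ : ∀ v hv, ∃ h, σ (Projectivization.mk F4 v hv) = Projectivization.mk F4 (f v) h)
    {g : Gen} (hf : ∀ x, f (vec ζ x) = vec ζ (genCoord g x))
    {n : Fin 24} (hn : n.val < 21) (h : (genTable g n).val < 21) :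
    σ (planePt ζ (coords n)) = planePt ζ (coords (genTable g n)) := by
  obtain ⟨c, hc, hgc⟩ := genCoord_coords g n hn h
  have h0 : vec ζ (coords n) ≠ 0 := fun h0 => coords_ne n (vec_eq_zero.1 h0)
  obtain ⟨h1, h2⟩ := hσ _ h0
  rw [planePt_of_ne h0, h2, ← planePt_smulVec hc, ← hgc]
  rw [hf] at h1
  rw [planePt_of_ne h1]
  congr 1
  exact hf _

theorem pslHom_mk (M : Matrix.SpecialLinearGroup (Fin 3) F4) (v : Fin 3 → F4) (hv : v ≠ 0) :
    ∃ h, Projectivization.PSLAction.toPermHom (M : PSL34) (Projectivization.mk F4 v hv) =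
      Projectivization.mk F4 (M.1.mulVec v) h :=
  ⟨(smul_ne_zero_iff_ne M).2 hv, rfl⟩

theorem coordPerm_mk (f hs hf) (v : Fin 3 → F4) (hv : v ≠ 0) :
    ∃ h, coordPerm f hs hf (Projectivization.mk F4 v hv) = Projectivization.mk F4 (f v) h :=
  ⟨ne_zero_of_involutive f hs hf v hv, rfl⟩

theorem pt_plane {ζ : F4ˣ} {n : Fin 24} (hn : n.val < 21) :
    pt ζ n = Sum.inl (planePt ζ (coords n)) := if_pos hn

theorem extendPerm_pt {ζ : F4ˣ} {σ : Equiv.Perm Plane} {f : (Fin 3 → F4) → Fin 3 → F4}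
    (hσ : ∀ v hv, ∃ h, σ (Projectivization.mk F4 v hv) = Projectivization.mk F4 (f v) h)
    {g : Gen} (hf : ∀ x, f (vec ζ x) = vec ζ (genCoord g x))
    {n : Fin 24} (hn : n.val < 21) (h : (genTable g n).val < 21) :
    extendPerm σ (pt ζ n) = pt ζ (genTable g n) := by
  rw [pt_plane hn, pt_plane h]
  exact congrArg Sum.inl (map_planePt hσ hf hn h)

theorem planePt_zero (ζ : F4ˣ) : planePt ζ (coords 0) = q2 := by
  have h0 : vec ζ (coords 0) ≠ 0 := fun h0 => coords_ne 0 (vec_eq_zero.1 h0)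
  rw [planePt_of_ne h0, q2]
  congr 1

theorem quadPerm_q2 : quadPerm q2 = q2 := by
  obtain ⟨h, h'⟩ := coordPerm_mk (fun p => ![p 0 ^ 2 + p 1 * p 2, p 1 ^ 2, p 2 ^ 2]) _ _
    ![1, 0, 0] (by intro h; simpa using congrFun h 0)
  rw [q2]
  refine h'.trans ?_
  congr 1
  ext i; fin_cases i <;> simp

theorem genTable_lt {g : Gen} (hg : g ≠ Gen.u) {n : Fin 24} (hn : n.val < 21) :
    (genTable g n).val < 21 := by
  revert n
  cases g
  case u => exact absurd rfl hg
  all_goals decide +kernel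

theorem genTable_u_lt {n : Fin 24} (hn : n.val < 21) (h0 : n ≠ 0) :
    (genTable Gen.u n).val < 21 := by
  revert n
  decide +kernel

theorem eq_of_not_lt {n : Fin 24} (hn : ¬ n.val < 21) : n = 21 ∨ n = 22 ∨ n = 23 := by
  revert n
  decide +kernel

theorem swap_inl {x y : NewPoint} [DecidableEq Point24] (p : Plane) :
    Equiv.swap (Sum.inr x) (Sum.inr y) (Sum.inl p : Point24) = Sum.inl p :=
  Equiv.swap_apply_of_ne_of_ne (by simp) (by simp)

theorem genPerm_linear {ζ : F4ˣ} {g : Gen} (hg : g ≠ Gen.u)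
    (M : Matrix.SpecialLinearGroup (Fin 3) F4)
    (hf : ∀ x, M.1.mulVec (vec ζ x) = vec ζ (genCoord g x))
    (hnew : genTable g 21 = 21 ∧ genTable g 22 = 22 ∧ genTable g 23 = 23) (n : Fin 24) :
    pslHom (M : PSL34) (pt ζ n) = pt ζ (genTable g n) := by
  by_cases hn : n.val < 21
  · exact extendPerm_pt (pslHom_mk M) hf hn (genTable_lt hg hn)
  · rcases eq_of_not_lt hn with rfl | rfl | rfl
    · rw [hnew.1]; rfl
    · rw [hnew.2.1]; rfl
    · rw [hnew.2.2]; rfl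

theorem inv_primitive (ζ : F4ˣ) : ((ζ⁻¹ : F4ˣ) : F4) = ζ ^ 2 := by
  have h := unit_pow_three ζ
  have h2 : (ζ : F4) * ((ζ⁻¹ : F4ˣ) : F4) = 1 := Units.mul_inv ζ
  linear_combination (-((ζ⁻¹ : F4ˣ) : F4)) * h + (ζ : F4) ^ 2 * h2

theorem genTable_u_ne {n : Fin 24} (hn : n.val < 21) : genTable Gen.u n ≠ 0 := by
  revert n
  decide +kernel

theorem eq_zero_of_coords {n : Fin 24} (h1 : (coords n).2.1 = K4.o) (h2 : (coords n).2.2 = K4.o) :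
    n = 0 := by
  revert n
  decide +kernel

/-- The only instance of injectivity of the numbering that is needed: the swap in `S3` must not
touch other points of the plane. -/
theorem eq_zero_of_planePt_eq {ζ : F4ˣ} {n : Fin 24} (h : planePt ζ (coords n) = q2) :
    n = 0 := by
  have h0 : vec ζ (coords n) ≠ 0 := fun h0 => coords_ne n (vec_eq_zero.1 h0)
  rw [planePt_of_ne h0, q2, Projectivization.mk_eq_mk_iff'] at h
  obtain ⟨a, ha⟩ := h
  have h1 := congrFun ha 1
  have h2 := congrFun ha 2
  simp only [vec, Pi.smul_apply, Matrix.cons_val, smul_zero] at h1 h2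
  exact eq_zero_of_coords (toF_eq_zero.1 h1.symm) (toF_eq_zero.1 h2.symm)

theorem genPerm_pt {ζ : F4ˣ} (hζ : ∀ x : F4ˣ, x ∈ Subgroup.zpowers ζ) (g : Gen) (n : Fin 24) :
    genPerm ζ g (pt ζ n) = pt ζ (genModel g n) := by
  classical
  change _ = pt ζ (genTable g n)
  cases g
  · refine genPerm_linear (g := Gen.s) (fun h => by cases h) matS ?_ (by decide) n
    rintro ⟨x, y, z⟩
    ext i; fin_cases i <;> simp [matS, vec, genCoord, toF_add hζ, Matrix.mulVec, Matrix.vecHead, Matrix.vecTail]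
  · refine genPerm_linear (g := Gen.j) (fun h => by cases h) matJ ?_ (by decide) n
    rintro ⟨x, y, z⟩
    ext i; fin_cases i <;> simp [matJ, vec, genCoord, Matrix.mulVec, Matrix.vecHead, Matrix.vecTail]
  · refine genPerm_linear (g := Gen.t) (fun h => by cases h) matT ?_ (by decide) n
    rintro ⟨x, y, z⟩
    ext i; fin_cases i <;> simp [matT, vec, genCoord, Matrix.mulVec, Matrix.vecHead, Matrix.vecTail]
  · refine genPerm_linear (g := Gen.r) (fun h => by cases h) (matR ζ) ?_ (by decide) n
    rintro ⟨x, y, z⟩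
    ext i
    fin_cases i
    · simp [matR, vec, genCoord, toF_rot, Matrix.mulVec, Matrix.vecHead, Matrix.vecTail]
    · simp [matR, vec, genCoord, toF_rot, Matrix.mulVec, Matrix.vecHead, Matrix.vecTail]
    · have h := inv_primitive ζ
      simp [matR, vec, genCoord, toF_rot, Matrix.mulVec, Matrix.vecHead, Matrix.vecTail] at h ⊢
      rw [h]; ring
  · have hf : ∀ x, (fun p : Fin 3 → F4 => ![p 0 ^ 2 + p 1 * p 2, p 1 ^ 2, p 2 ^ 2]) (vec ζ x) =
        vec ζ (genCoord Gen.u x) := by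
      rintro ⟨x, y, z⟩
      ext i
      fin_cases i <;> simp [vec, genCoord, toF_add hζ, toF_mul, pow_two]
    have hσ : ∀ v hv, ∃ h, quadPerm (Projectivization.mk F4 v hv) = Projectivization.mk F4
        ((fun p : Fin 3 → F4 => ![p 0 ^ 2 + p 1 * p 2, p 1 ^ 2, p 2 ^ 2]) v) h :=
      coordPerm_mk (fun p => ![p 0 ^ 2 + p 1 * p 2, p 1 ^ 2, p 2 ^ 2]) _ _
    change Equiv.swap _ _ (extendPerm quadPerm (pt ζ n)) = _
    by_cases hn : n.val < 21
    · by_cases h0 : n = 0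
      · subst h0
        rw [pt_plane hn, planePt_zero]
        change Equiv.swap _ _ (Sum.inl (quadPerm q2)) = _
        rw [quadPerm_q2, Equiv.swap_apply_left]
        rfl
      · have hlt := genTable_u_lt hn h0
        rw [extendPerm_pt hσ hf hn hlt, pt_plane hlt, ← planePt_zero ζ]
        refine Equiv.swap_apply_of_ne_of_ne ?_ (by simp)
        rw [planePt_zero]
        intro h
        exact genTable_u_ne hn (eq_zero_of_planePt_eq (Sum.inl_injective h))
    · rcases eq_of_not_lt hn with rfl | rfl | rfl
      · change Equiv.swap _ _ (Sum.inr NewPoint.u) = _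
        rw [Equiv.swap_apply_right, ← planePt_zero ζ]
        rfl
      · exact Equiv.swap_apply_of_ne_of_ne (fun h => by cases h) (fun h => by cases h)
      · exact Equiv.swap_apply_of_ne_of_ne (fun h => by cases h) (fun h => by cases h)
  · have hf : ∀ x, (fun p : Fin 3 → F4 => ![p 0 ^ 2, p 1 ^ 2, (ζ : F4) * p 2 ^ 2]) (vec ζ x) =
        vec ζ (genCoord Gen.v x) := by
      rintro ⟨x, y, z⟩
      ext i
      fin_cases i <;> simp [vec, genCoord, toF_mul, toF_rot, pow_two]
    have hσ : ∀ v hv, ∃ h, (frobPerm ζ) (Projectivization.mk F4 v hv) = Projectivization.mk F4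
        ((fun p : Fin 3 → F4 => ![p 0 ^ 2, p 1 ^ 2, (ζ : F4) * p 2 ^ 2]) v) h :=
      coordPerm_mk (fun p => ![p 0 ^ 2, p 1 ^ 2, (ζ : F4) * p 2 ^ 2]) _ _
    change Equiv.swap _ _ (extendPerm (frobPerm ζ) (pt ζ n)) = _
    by_cases hn : n.val < 21
    · have hlt := genTable_lt (g := Gen.v) (fun h => by cases h) hn
      rw [extendPerm_pt hσ hf hn hlt, pt_plane hlt, swap_inl]
    · rcases eq_of_not_lt hn with rfl | rfl | rfl
      · exact Equiv.swap_apply_left _ _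
      · exact Equiv.swap_apply_right _ _
      · exact Equiv.swap_apply_of_ne_of_ne (fun h => by cases h) (fun h => by cases h)
  · have hf : ∀ x, (fun p : Fin 3 → F4 => ![p 0 ^ 2, p 1 ^ 2, ((1 : F4ˣ) : F4) * p 2 ^ 2])
        (vec ζ x) = vec ζ (genCoord Gen.w x) := by
      rintro ⟨x, y, z⟩
      ext i
      fin_cases i <;> simp [vec, genCoord, toF_mul, pow_two]
    have hσ : ∀ v hv, ∃ h, (frobPerm 1) (Projectivization.mk F4 v hv) = Projectivization.mk F4
        ((fun p : Fin 3 → F4 => ![p 0 ^ 2, p 1 ^ 2, ((1 : F4ˣ) : F4) * p 2 ^ 2]) v) h :=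
      coordPerm_mk (fun p => ![p 0 ^ 2, p 1 ^ 2, ((1 : F4ˣ) : F4) * p 2 ^ 2]) _ _
    change Equiv.swap _ _ (extendPerm (frobPerm 1) (pt ζ n)) = _
    by_cases hn : n.val < 21
    · have hlt := genTable_lt (g := Gen.w) (fun h => by cases h) hn
      rw [extendPerm_pt hσ hf hn hlt, pt_plane hlt, swap_inl]
    · rcases eq_of_not_lt hn with rfl | rfl | rfl
      · exact Equiv.swap_apply_of_ne_of_ne (fun h => by cases h) (fun h => by cases h)
      · exact Equiv.swap_apply_left _ _
      · exact Equiv.swap_apply_right _ _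

/-- The numbering intertwines the two actions of words, so as it is surjective, a word trivial on
the numbers is trivial on the points. -/
theorem lift_pt {ζ : F4ˣ} (hζ : ∀ x : F4ˣ, x ∈ Subgroup.zpowers ζ) (x : FreeGroup Gen)
    (n : Fin 24) :
    FreeGroup.lift (genPerm ζ) x (pt ζ n) = pt ζ (FreeGroup.lift genModel x n) := by
  induction x using FreeGroup.induction_on generalizing n with
  | C1 => simp
  | of g => simpa using genPerm_pt hζ g n
  | inv_of g ih =>
    rw [map_inv, map_inv, Equiv.Perm.inv_eq_iff_eq, ih, Equiv.Perm.inv_def, Equiv.apply_symm_apply]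
  | mul x y hx hy => rw [map_mul, map_mul, Equiv.Perm.mul_apply, Equiv.Perm.mul_apply, hy, hx]

theorem rels_genPerm {ζ : F4ˣ} (hζ : ∀ x : F4ˣ, x ∈ Subgroup.zpowers ζ) :
    ∀ x ∈ relsM24, FreeGroup.lift (genPerm ζ) x = 1 := by
  intro x hx
  ext p
  obtain ⟨n, rfl⟩ := pt_surjective hζ p
  rw [lift_pt hζ, rels_genModel x hx]
  rfl

open Matrix.SpecialLinearGroup (transvection)

/-! ### Matrices and root elements -/

namespace LinearTuple

variable {G H : Type*} [Group G] [Group H] (P : LinearTuple G)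

/-- The image of a tuple under a homomorphism. -/
def map (φ : G →* H) : LinearTuple H where
  s := φ P.s
  j := φ P.j
  t := φ P.t
  r := φ P.r
  s_sq := by simp only [← map_pow, P.s_sq, map_one]
  j_sq := by simp only [← map_pow, P.j_sq, map_one]
  t_sq := by simp only [← map_pow, P.t_sq, map_one]
  r_cube := by simp only [← map_pow, P.r_cube, map_one]
  jr_sq := by simp only [← map_pow, ← map_mul, P.jr_sq, map_one]
  tr_sq := by simp only [← map_pow, ← map_mul, P.tr_sq, map_one]
  sr_cube := by simp only [← map_pow, ← map_mul, P.sr_cube, map_one]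
  js_cube := by simp only [← map_pow, ← map_mul, P.js_cube, map_one]
  tj_cube := by simp only [← map_pow, ← map_mul, P.tj_cube, map_one]
  tstjs_cube := by simp only [← map_pow, ← map_mul, P.tstjs_cube, map_one]
  long := by simp only [← map_inv, ← map_mul, P.long]

variable (φ : G →* H)

theorem map_cR (x : G) : φ (P.cR x) = (P.map φ).cR (φ x) := by
  simp only [cR_apply, map_mul, map_inv]; rfl
theorem map_cJ (x : G) : φ (P.cJ x) = (P.map φ).cJ (φ x) := by
  simp only [cJ_apply, map_mul]; rfl
theorem map_cT (x : G) : φ (P.cT x) = (P.map φ).cT (φ x) := by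
  simp only [cT_apply, map_mul]; rfl
theorem map_x12 (c : K4) : φ (P.x12 c) = (P.map φ).x12 c := by
  cases c
  · exact map_one φ
  · rfl
  · exact P.map_cR φ _
  · exact (P.map_cR φ _).trans (congrArg _ (P.map_cR φ _))
theorem map_x32 (c : K4) : φ (P.x32 c) = (P.map φ).x32 c := by
  rw [x32, map_cT, map_x12]; rfl
theorem map_x31 (c : K4) : φ (P.x31 c) = (P.map φ).x31 c := by
  rw [x31, map_cJ, map_x32]; rfl
theorem map_x13 (c : K4) : φ (P.x13 c) = (P.map φ).x13 c := by
  rw [x13, map_cT, map_x31]; rfl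
theorem map_x23 (c : K4) : φ (P.x23 c) = (P.map φ).x23 c := by
  rw [x23, map_cT, x21, map_cJ, map_x12]; rfl

theorem cJ_mem {M : Subgroup G} (hj : P.j ∈ M) {x : G} (hx : x ∈ M) : P.cJ x ∈ M := by
  rw [cJ_apply]; exact M.mul_mem (M.mul_mem hj hx) hj
theorem cT_mem {M : Subgroup G} (ht : P.t ∈ M) {x : G} (hx : x ∈ M) : P.cT x ∈ M := by
  rw [cT_apply]; exact M.mul_mem (M.mul_mem ht hx) ht

theorem linear_le_of_mem {M : Subgroup G} (hs : P.s ∈ M) (hj : P.j ∈ M) (ht : P.t ∈ M)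
    (hr : P.r ∈ M) : P.linear ≤ M :=
  P.linear_le hs hr hj (P.cT_mem ht (P.cJ_mem hj hs)) (P.cT_mem ht hs)

end LinearTuple

/-- The action of matrices on the 24 points. -/
def slHom : Matrix.SpecialLinearGroup (Fin 3) F4 →* Equiv.Perm Point24 :=
  pslHom.comp (QuotientGroup.mk' _)

/-- PSL₃(4) acts faithfully on the plane, so M lies in the centre of SL₃(4), which consists of
scalars. -/
theorem scalar_of_slHom_eq_one {M : Matrix.SpecialLinearGroup (Fin 3) F4} (h : slHom M = 1) :
    ∃ a : F4, M.1 = Matrix.scalar (Fin 3) a := by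
  have h1 : (M : PSL34) = 1 := by
    apply Matrix.ProjectiveSpecialLinearGroup.toPermHom_injective
    rw [map_one]
    ext p
    have h2 : slHom M (Sum.inl p) = Sum.inl p := by rw [h]; rfl
    exact Sum.inl_injective h2
  rw [QuotientGroup.eq_one_iff, Matrix.SpecialLinearGroup.mem_center_iff] at h1
  obtain ⟨a, -, ha⟩ := h1
  exact ⟨a, ha.symm⟩

section MatrixIdentities

variable (ζ : F4ˣ) (c : F4)

/-- The elementary matrix with `c` in position `(0, 1)`. -/
abbrev T01 : Matrix.SpecialLinearGroup (Fin 3) F4 :=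
  transvection (i := 0) (j := 1) (by decide) c
/-- The elementary matrix with `c` in position `(1, 0)`. -/
abbrev T10 : Matrix.SpecialLinearGroup (Fin 3) F4 :=
  transvection (i := 1) (j := 0) (by decide) c
/-- The elementary matrix with `c` in position `(0, 2)`. -/
abbrev T02 : Matrix.SpecialLinearGroup (Fin 3) F4 :=
  transvection (i := 0) (j := 2) (by decide) c
/-- The elementary matrix with `c` in position `(2, 0)`. -/
abbrev T20 : Matrix.SpecialLinearGroup (Fin 3) F4 :=
  transvection (i := 2) (j := 0) (by decide) c
/-- The elementary matrix with `c` in position `(1, 2)`. -/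
abbrev T12 : Matrix.SpecialLinearGroup (Fin 3) F4 :=
  transvection (i := 1) (j := 2) (by decide) c
/-- The elementary matrix with `c` in position `(2, 1)`. -/
abbrev T21 : Matrix.SpecialLinearGroup (Fin 3) F4 :=
  transvection (i := 2) (j := 1) (by decide) c
theorem coe_T01 : (T01 c).1 = !![1, c, 0; 0, 1, 0; 0, 0, 1] := by
  rw [Matrix.SpecialLinearGroup.transvection_coe]
  ext x y; fin_cases x <;> fin_cases y <;> simp
theorem coe_T10 : (T10 c).1 = !![1, 0, 0; c, 1, 0; 0, 0, 1] := by
  rw [Matrix.SpecialLinearGroup.transvection_coe]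
  ext x y; fin_cases x <;> fin_cases y <;> simp
theorem coe_T02 : (T02 c).1 = !![1, 0, c; 0, 1, 0; 0, 0, 1] := by
  rw [Matrix.SpecialLinearGroup.transvection_coe]
  ext x y; fin_cases x <;> fin_cases y <;> simp
theorem coe_T20 : (T20 c).1 = !![1, 0, 0; 0, 1, 0; c, 0, 1] := by
  rw [Matrix.SpecialLinearGroup.transvection_coe]
  ext x y; fin_cases x <;> fin_cases y <;> simp
theorem coe_T12 : (T12 c).1 = !![1, 0, 0; 0, 1, c; 0, 0, 1] := by
  rw [Matrix.SpecialLinearGroup.transvection_coe]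
  ext x y; fin_cases x <;> fin_cases y <;> simp
theorem coe_T21 : (T21 c).1 = !![1, 0, 0; 0, 1, 0; 0, c, 1] := by
  rw [Matrix.SpecialLinearGroup.transvection_coe]
  ext x y; fin_cases x <;> fin_cases y <;> simp
theorem coe_matS : matS.1 = !![1, 1, 0; 0, 1, 0; 0, 0, 1] := rfl
theorem coe_matJ : matJ.1 = !![0, 1, 0; 1, 0, 0; 0, 0, 1] := rfl
theorem coe_matT : matT.1 = !![0, 0, 1; 0, 1, 0; 1, 0, 0] := rfl
theorem coe_matR : (matR ζ).1 = !![(ζ : F4), 0, 0; 0, 1, 0; 0, 0, ((ζ⁻¹ : F4ˣ) : F4)] := rfl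

theorem matR_transvection :
    matR ζ * T01 c * (matR ζ)⁻¹ = T01 (ζ * c) := by
  rw [mul_inv_eq_iff_eq_mul]
  apply Subtype.ext
  rw [Matrix.SpecialLinearGroup.coe_mul, Matrix.SpecialLinearGroup.coe_mul]
  simp [coe_matR, coe_T01, Matrix.vecHead, Matrix.vecTail]

theorem matJ_transvection01 : matJ * T01 c * matJ⁻¹ = T10 c := by
  rw [mul_inv_eq_iff_eq_mul]
  apply Subtype.ext
  rw [Matrix.SpecialLinearGroup.coe_mul, Matrix.SpecialLinearGroup.coe_mul]
  simp [coe_matJ, coe_T01, coe_T10, Matrix.vecHead, Matrix.vecTail]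
theorem matJ_transvection21 : matJ * T21 c * matJ⁻¹ = T20 c := by
  rw [mul_inv_eq_iff_eq_mul]
  apply Subtype.ext
  rw [Matrix.SpecialLinearGroup.coe_mul, Matrix.SpecialLinearGroup.coe_mul]
  simp [coe_matJ, coe_T21, coe_T20, Matrix.vecHead, Matrix.vecTail]
theorem matT_transvection01 : matT * T01 c * matT⁻¹ = T21 c := by
  rw [mul_inv_eq_iff_eq_mul]
  apply Subtype.ext
  rw [Matrix.SpecialLinearGroup.coe_mul, Matrix.SpecialLinearGroup.coe_mul]
  simp [coe_matT, coe_T01, coe_T21, Matrix.vecHead, Matrix.vecTail]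
theorem matT_transvection20 : matT * T20 c * matT⁻¹ = T02 c := by
  rw [mul_inv_eq_iff_eq_mul]
  apply Subtype.ext
  rw [Matrix.SpecialLinearGroup.coe_mul, Matrix.SpecialLinearGroup.coe_mul]
  simp [coe_matT, coe_T20, coe_T02, Matrix.vecHead, Matrix.vecTail]
theorem matT_transvection10 : matT * T10 c * matT⁻¹ = T12 c := by
  rw [mul_inv_eq_iff_eq_mul]
  apply Subtype.ext
  rw [Matrix.SpecialLinearGroup.coe_mul, Matrix.SpecialLinearGroup.coe_mul]
  simp [coe_matT, coe_T10, coe_T12, Matrix.vecHead, Matrix.vecTail]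

theorem matS_eq : matS = T01 1 := by
  exact Subtype.ext (by rw [coe_matS, coe_T01])

variable {ζ} {P : LinearTuple (Equiv.Perm Point24)} (hs : P.s = slHom matS) (hj : P.j = slHom matJ)
  (ht : P.t = slHom matT) (hr : P.r = slHom (matR ζ))

include hs hr in
theorem x12_eq_slHom (d : K4) : P.x12 d = slHom (T01 (K4.toF ζ d)) := by
  have step : ∀ d, P.x12 d = slHom (T01 (K4.toF ζ d)) →
      P.x12 d.rot = slHom (T01 (K4.toF ζ d.rot)) := fun d h => by
    rw [← P.cR_x12, h, P.cR_apply, hr, ← map_inv, ← map_mul, ← map_mul, matR_transvection, toF_rot]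
  have h1 : P.x12 K4.e = slHom (T01 (K4.toF ζ K4.e)) := by
    rw [P.x12_one, hs, matS_eq, show K4.toF ζ K4.e = 1 from rfl]
  cases d
  · rw [P.x12_zero, show T01 (K4.toF ζ K4.o) = 1 from
      Matrix.SpecialLinearGroup.transvection_coeff_zero _, map_one]
  · exact h1
  · exact step _ h1
  · exact step _ (step _ h1)

include hj in
theorem cJ_slHom (M : Matrix.SpecialLinearGroup (Fin 3) F4) :
    P.cJ (slHom M) = slHom (matJ * M * matJ⁻¹) := by
  rw [LinearTuple.cJ, MulAut.conj_apply, hj, ← map_inv, ← map_mul, ← map_mul]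

include ht in
theorem cT_slHom (M : Matrix.SpecialLinearGroup (Fin 3) F4) :
    P.cT (slHom M) = slHom (matT * M * matT⁻¹) := by
  rw [LinearTuple.cT, MulAut.conj_apply, ht, ← map_inv, ← map_mul, ← map_mul]

include hs hr ht in
theorem x32_eq_slHom (d : K4) : P.x32 d = slHom (T21 (K4.toF ζ d)) := by
  rw [LinearTuple.x32, x12_eq_slHom hs hr, cT_slHom ht, matT_transvection01]

include hs hr ht hj in
theorem x31_eq_slHom (d : K4) : P.x31 d = slHom (T20 (K4.toF ζ d)) := by
  rw [LinearTuple.x31, x32_eq_slHom hs ht hr, cJ_slHom hj, matJ_transvection21]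

include hs hr ht hj in
theorem x13_eq_slHom (d : K4) : P.x13 d = slHom (T02 (K4.toF ζ d)) := by
  rw [LinearTuple.x13, x31_eq_slHom hs hj ht hr, cT_slHom ht, matT_transvection20]

include hs hr hj in
theorem x21_eq_slHom (d : K4) : P.x21 d = slHom (T10 (K4.toF ζ d)) := by
  rw [LinearTuple.x21, x12_eq_slHom hs hr, cJ_slHom hj, matJ_transvection01]

include hs hr ht hj in
theorem x23_eq_slHom (d : K4) : P.x23 d = slHom (T12 (K4.toF ζ d)) := by
  rw [LinearTuple.x23, x21_eq_slHom hs hj hr, cT_slHom ht, matT_transvection10]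

theorem matR_pow (n : ℕ) :
    ((matR ζ) ^ n).1 = Matrix.diagonal ![(ζ : F4) ^ n, 1, ((ζ⁻¹ : F4ˣ) : F4) ^ n] := by
  have h : (matR ζ).1 = Matrix.diagonal ![(ζ : F4), 1, ((ζ⁻¹ : F4ˣ) : F4)] := by
    ext x y; fin_cases x <;> fin_cases y <;> simp [matR]
  rw [Matrix.SpecialLinearGroup.coe_pow, h, Matrix.diagonal_pow]
  congr 1
  ext i; fin_cases i <;> simp

theorem matJ_matR_matJ_pow (n : ℕ) :
    ((matJ * matR ζ * matJ⁻¹) ^ n).1 =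
      Matrix.diagonal ![1, (ζ : F4) ^ n, ((ζ⁻¹ : F4ˣ) : F4) ^ n] := by
  have h : (matJ * matR ζ * matJ⁻¹).1 = Matrix.diagonal ![1, (ζ : F4), ((ζ⁻¹ : F4ˣ) : F4)] := by
    have hJ : matJ⁻¹ = matJ := by
      rw [inv_eq_iff_mul_eq_one]
      apply Subtype.ext
      rw [Matrix.SpecialLinearGroup.coe_mul, Matrix.SpecialLinearGroup.coe_one, coe_matJ]
      ext x y
      fin_cases x <;> fin_cases y <;> simp
    rw [hJ, Matrix.SpecialLinearGroup.coe_mul, Matrix.SpecialLinearGroup.coe_mul, coe_matJ, coe_matR]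
    ext x y; fin_cases x <;> fin_cases y <;> simp
  rw [Matrix.SpecialLinearGroup.coe_pow, h, Matrix.diagonal_pow]
  congr 1
  ext i; fin_cases i <;> simp

theorem exists_pow_eq (hζ : ∀ x : F4ˣ, x ∈ Subgroup.zpowers ζ) {x : F4} (hx : x ≠ 0) :
    ∃ n : ℕ, x = (ζ : F4) ^ n := by
  obtain ⟨d, rfl⟩ := toF_surjective hζ x
  cases d
  · exact absurd rfl hx
  · exact ⟨0, (pow_zero _).symm⟩
  · exact ⟨1, (pow_one _).symm⟩
  · exact ⟨2, rfl⟩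

include hs hr ht hj in
theorem slHom_mem (hζ : ∀ x : F4ˣ, x ∈ Subgroup.zpowers ζ) {N : Subgroup (Equiv.Perm Point24)}
    (hsN : P.s ∈ N) (hjN : P.j ∈ N) (htN : P.t ∈ N) (hrN : P.r ∈ N)
    (M : Matrix.SpecialLinearGroup (Fin 3) F4) : slHom M ∈ N := by
  -- The induction principle speaks of plain matrices, so membership is phrased through some lift of
  -- determinant 1.
  have key : ∃ g : Matrix.SpecialLinearGroup (Fin 3) F4, slHom g ∈ N ∧ g.1 = M.1 := by
    apply Matrix.diagonal_transvection_induction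
      (fun A => ∃ g : Matrix.SpecialLinearGroup (Fin 3) F4, slHom g ∈ N ∧ g.1 = A) M.1
    · intro D hD
      rw [M.2, Matrix.det_diagonal, Fin.prod_univ_three] at hD
      have h0 : D 0 ≠ 0 := fun h => by simp [h] at hD
      have h1 : D 1 ≠ 0 := fun h => by simp [h] at hD
      obtain ⟨m, hm⟩ := exists_pow_eq hζ h0
      obtain ⟨n, hn⟩ := exists_pow_eq hζ h1
      -- These factors are diag(ζᵐ, 1, ζ⁻ᵐ) and diag(1, ζⁿ, ζ⁻ⁿ); the third entry is then forced by
      -- the determinant.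
      refine ⟨matR ζ ^ m * (matJ * matR ζ * matJ⁻¹) ^ n, ?_, ?_⟩
      · rw [map_mul, map_pow, map_pow, map_mul, map_mul, map_inv, ← hj, ← hr]
        exact N.mul_mem (N.pow_mem hrN _)
          (N.pow_mem (N.mul_mem (N.mul_mem hjN hrN) (N.inv_mem hjN)) _)
      · rw [Matrix.SpecialLinearGroup.coe_mul, matR_pow, matJ_matR_matJ_pow,
          Matrix.diagonal_mul_diagonal]
        congr 1
        have h2 : D 2 = ((ζ⁻¹ : F4ˣ) : F4) ^ m * ((ζ⁻¹ : F4ˣ) : F4) ^ n := by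
          have e : ((ζ : F4) ^ m * (ζ : F4) ^ n) *
              (((ζ⁻¹ : F4ˣ) : F4) ^ m * ((ζ⁻¹ : F4ˣ) : F4) ^ n) = 1 := by
            rw [← pow_add, ← pow_add, ← mul_pow, Units.mul_inv, one_pow]
          rw [hm, hn] at hD
          rw [hm] at h0
          rw [hn] at h1
          exact mul_left_cancel₀ (mul_ne_zero h0 h1) (hD.trans e.symm)
        ext i; fin_cases i <;> simp [hm, hn, h2]
    · rintro ⟨i, k, hik, c⟩
      refine ⟨transvection hik c, ?_, rfl⟩
      obtain ⟨d, rfl⟩ := toF_surjective hζ c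
      have m12 : P.x12 d ∈ N := P.x12_mem hrN hsN d
      have m32 : P.x32 d ∈ N := P.cT_mem htN m12
      have m31 : P.x31 d ∈ N := P.cJ_mem hjN m32
      have m13 : P.x13 d ∈ N := P.cT_mem htN m31
      have m21 : P.x21 d ∈ N := P.cJ_mem hjN m12
      have m23 : P.x23 d ∈ N := P.cT_mem htN m21
      rw [x12_eq_slHom hs hr] at m12
      rw [x32_eq_slHom hs ht hr] at m32
      rw [x31_eq_slHom hs hj ht hr] at m31
      rw [x13_eq_slHom hs hj ht hr] at m13
      rw [x21_eq_slHom hs hj hr] at m21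
      rw [x23_eq_slHom hs hj ht hr] at m23
      fin_cases i <;> fin_cases k
      · exact absurd rfl hik
      · exact m12
      · exact m13
      · exact m21
      · exact absurd rfl hik
      · exact m23
      · exact m31
      · exact m32
      · exact absurd rfl hik
    · rintro A B ⟨g, hg, rfl⟩ ⟨h, hh, rfl⟩
      exact ⟨g * h, by rw [map_mul]; exact N.mul_mem hg hh, rfl⟩
  obtain ⟨g, hg, h⟩ := key
  rwa [show g = M from Subtype.ext h] at hg

end MatrixIdentities

/-! ### Faithfulness of the linear part -/

section Faithful

variable {ζ : F4ˣ} (hζ : ∀ x : F4ˣ, x ∈ Subgroup.zpowers ζ) {G : Type*} [Group G]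
  {P : LinearTuple G} {φ : G →* Equiv.Perm Point24} (hs : φ P.s = slHom matS)
  (hj : φ P.j = slHom matJ) (ht : φ P.t = slHom matT) (hr : φ P.r = slHom (matR ζ))

theorem coe_upper (c d f : F4) (n : ℕ) :
    (T01 c * T02 d * T12 f * matR ζ ^ n).1 =
      !![(ζ : F4) ^ n, c, (c * f + d) * ((ζ⁻¹ : F4ˣ) : F4) ^ n;
        0, 1, f * ((ζ⁻¹ : F4ˣ) : F4) ^ n; 0, 0, ((ζ⁻¹ : F4ˣ) : F4) ^ n] := by
  rw [Matrix.SpecialLinearGroup.coe_mul, Matrix.SpecialLinearGroup.coe_mul,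
    Matrix.SpecialLinearGroup.coe_mul, matR_pow, coe_T01, coe_T02, coe_T12]
  ext x y
  fin_cases x <;> fin_cases y <;> simp [Matrix.mul_apply, Fin.sum_univ_three]

include hs hj ht hr in
theorem map_borel_form {x : G} (hx : x ∈ P.borel) :
    ∃ c d f n, x = P.x12 c * P.x13 d * P.x23 f * P.r ^ n ∧
      φ x = slHom (T01 (K4.toF ζ c) * T02 (K4.toF ζ d) * T12 (K4.toF ζ f) * matR ζ ^ n) := by
  obtain ⟨c, d, f, n, rfl⟩ := P.borel_normal_form hx
  refine ⟨c, d, f, n, rfl, ?_⟩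
  rw [map_mul, map_mul, map_mul, map_pow, P.map_x12, P.map_x13, P.map_x23,
    x12_eq_slHom (P := P.map φ) hs hr, x13_eq_slHom (P := P.map φ) hs hj ht hr,
    x23_eq_slHom (P := P.map φ) hs hj ht hr, hr, ← map_pow, ← map_mul, ← map_mul, ← map_mul]

include hζ hs hj ht hr in
-- The matrix of the normal form must be scalar. Its off-diagonal entries kill c, f and then d; its
-- middle entry 1 makes ζⁿ = 1, so 3 divides n and rⁿ = 1.
theorem eq_one_of_mem_borel {x : G} (hx : x ∈ P.borel) (h1 : φ x = 1) : x = 1 := by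
  obtain ⟨c, d, f, n, rfl, h⟩ := map_borel_form hs hj ht hr hx
  rw [h] at h1
  obtain ⟨a, ha⟩ := scalar_of_slHom_eq_one h1
  rw [coe_upper] at ha
  have e00 := congrFun (congrFun ha 0) 0
  have e01 := congrFun (congrFun ha 0) 1
  have e02 := congrFun (congrFun ha 0) 2
  have e11 := congrFun (congrFun ha 1) 1
  have e12 := congrFun (congrFun ha 1) 2
  simp at e00 e01 e02 e11 e12
  have hc := toF_eq_zero.1 e01
  have hf := toF_eq_zero.1 e12
  rw [e01, zero_mul, zero_add] at e02
  have hd := toF_eq_zero.1 e02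
  have hn : P.r ^ n = 1 := by
    have hz : ζ ^ n = 1 := Units.ext (by rw [Units.val_pow_eq_pow_val, e00, ← e11, Units.val_one])
    have h3 : ζ ^ 3 = 1 :=
      Units.ext (by rw [Units.val_pow_eq_pow_val, unit_pow_three, Units.val_one])
    have ho : orderOf ζ = 3 := orderOf_eq_prime h3 (primitive_ne_one hζ)
    obtain ⟨m, rfl⟩ := ho ▸ orderOf_dvd_of_pow_eq_one hz
    rw [pow_mul, P.r_cube, one_pow]
  rw [hc, hd, hf, hn, P.x12_zero, P.x13_zero, P.x23_zero]
  simp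

include hs hj ht hr in
-- Even up to a scalar, the matrix of k has a nonzero entry below the diagonal, unlike those of
-- `borel`.
theorem map_k_not_mem : φ P.k ∉ P.borel.map φ := by
  rintro ⟨x, hx, h⟩
  obtain ⟨c, d, f, n, -, hφ⟩ := map_borel_form hs hj ht hr hx
  set U := T01 (K4.toF ζ c) * T02 (K4.toF ζ d) * T12 (K4.toF ζ f) * matR ζ ^ n with hU
  have hk : φ P.k = slHom (matT * matJ * matT) := by
    rw [LinearTuple.k, map_mul, map_mul, ht, hj, map_mul, map_mul]
  have h1 : slHom (matT * matJ * matT * U⁻¹) = 1 := by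
    rw [map_mul, ← hk, map_inv, ← hφ, h, mul_inv_cancel]
  obtain ⟨a, ha⟩ := scalar_of_slHom_eq_one h1
  have h2 : (matT * matJ * matT).1 = Matrix.scalar (Fin 3) a * U.1 := by
    rw [← ha, ← Matrix.SpecialLinearGroup.coe_mul, inv_mul_cancel_right]
  have e := congrFun (congrFun h2 2) 1
  rw [hU, coe_upper, Matrix.SpecialLinearGroup.coe_mul, Matrix.SpecialLinearGroup.coe_mul,
    coe_matT, coe_matJ] at e
  simp [Matrix.mul_apply, Fin.sum_univ_three, Matrix.vecHead, Matrix.vecTail] at e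

theorem slHom_q2 (M : Matrix.SpecialLinearGroup (Fin 3) F4) :
    slHom M (Sum.inl q2) = Sum.inl q2 ↔ M.1 1 0 = 0 ∧ M.1 2 0 = 0 := by
  have h0 : (![1, 0, 0] : Fin 3 → F4) ≠ 0 := fun h => by simpa using congrFun h 0
  obtain ⟨h, h'⟩ := pslHom_mk M ![1, 0, 0] h0
  have e : slHom M (Sum.inl q2) = Sum.inl (Projectivization.mk F4 (M.1.mulVec ![1, 0, 0]) h) :=
    congrArg Sum.inl h'
  have ev : M.1.mulVec ![1, 0, 0] = ![M.1 0 0, M.1 1 0, M.1 2 0] := by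
    ext i; fin_cases i <;> simp [Matrix.mulVec, dotProduct, Fin.sum_univ_three]
  rw [e, Sum.inl.injEq, q2, Projectivization.mk_eq_mk_iff', ev]
  constructor
  · rintro ⟨a, ha⟩
    have h1 := congrFun ha 1
    have h2 := congrFun ha 2
    simp at h1 h2
    exact ⟨h1.symm, h2.symm⟩
  · rintro ⟨h1, h2⟩
    refine ⟨M.1 0 0, ?_⟩
    ext i; fin_cases i <;> simp [h1, h2]

include hζ hs hj ht hr in
-- `para` fixes [1,0,0] and j moves it, so the kernel lies in `para`; `map_k_not_mem` then pushes it
-- into `borel`.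
theorem eq_one_of_mem_linear {x : G} (hx : x ∈ P.linear) (h1 : φ x = 1) : x = 1 := by
  refine eq_one_of_mem_borel hζ hs hj ht hr ?_ h1
  refine mem_of_map_eq_one φ (P.borel.map φ) (fun y hy => ⟨y, hy, rfl⟩)
    (map_k_not_mem hs hj ht hr) (P.para_cells ?_) h1
  refine mem_of_map_eq_one φ (MulAction.stabilizer _ (Sum.inl q2 : Point24)) ?_ ?_
    (P.linear_cells hx) h1
  · change P.para ≤ (MulAction.stabilizer _ (Sum.inl q2 : Point24)).comap φ
    apply P.para_le <;> rw [Subgroup.mem_comap, MulAction.mem_stabilizer_iff, Equiv.Perm.smul_def]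
    · rw [hs, slHom_q2, coe_matS]; simp
    · rw [hr, slHom_q2, coe_matR]; simp
    · rw [P.map_x23, x23_eq_slHom (P := P.map φ) hs hj ht hr, slHom_q2, coe_T12]; simp
    · rw [P.map_x32, x32_eq_slHom (P := P.map φ) hs ht hr, slHom_q2, coe_T21]; simp
  · rw [MulAction.mem_stabilizer_iff, Equiv.Perm.smul_def, hj, slHom_q2, coe_matJ]; simp

end Faithful

/-! ### The presentation -/

theorem slHom_new (M : Matrix.SpecialLinearGroup (Fin 3) F4) (p : NewPoint) :
    slHom M (Sum.inr p) = Sum.inr p := rfl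

theorem S3_u : S3 (Sum.inr NewPoint.u) = Sum.inl q2 := by
  classical
  change Equiv.swap (Sum.inl q2) (Sum.inr NewPoint.u) (Sum.inr NewPoint.u : Point24) = _
  exact Equiv.swap_apply_right _ _
theorem S3_v : S3 (Sum.inr NewPoint.v) = Sum.inr NewPoint.v := by
  classical
  change Equiv.swap (Sum.inl q2) (Sum.inr NewPoint.u) (Sum.inr NewPoint.v : Point24) = _
  exact Equiv.swap_apply_of_ne_of_ne (fun h => by cases h) (fun h => by cases h)
theorem S3_w : S3 (Sum.inr NewPoint.w) = Sum.inr NewPoint.w := by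
  classical
  change Equiv.swap (Sum.inl q2) (Sum.inr NewPoint.u) (Sum.inr NewPoint.w : Point24) = _
  exact Equiv.swap_apply_of_ne_of_ne (fun h => by cases h) (fun h => by cases h)
theorem S4_v (ζ : F4ˣ) : S4 ζ (Sum.inr NewPoint.v) = Sum.inr NewPoint.u := by
  classical
  change Equiv.swap _ _ (Sum.inr NewPoint.v : Point24) = _
  exact Equiv.swap_apply_right _ _
theorem S4_w (ζ : F4ˣ) : S4 ζ (Sum.inr NewPoint.w) = Sum.inr NewPoint.w := by
  classical
  change Equiv.swap _ _ (Sum.inr NewPoint.w : Point24) = _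
  exact Equiv.swap_apply_of_ne_of_ne (fun h => by cases h) (fun h => by cases h)
theorem S5_w : S5 (Sum.inr NewPoint.w) = Sum.inr NewPoint.v := by
  classical
  change Equiv.swap _ _ (Sum.inr NewPoint.w : Point24) = _
  exact Equiv.swap_apply_right _ _

/-! ### Faithfulness on the whole group -/

section Faithful

variable {ζ : F4ˣ} (hζ : ∀ x : F4ˣ, x ∈ Subgroup.zpowers ζ) {G : Type*} [Group G]
  {P : MathieuTuple G} {φ : G →* Equiv.Perm Point24} (hs : φ P.s = slHom matS)
  (hj : φ P.j = slHom matJ) (ht : φ P.t = slHom matT) (hr : φ P.r = slHom (matR ζ))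
  (hu : φ P.u = S3) (hv : φ P.v = S4 ζ) (hw : φ P.w = S5)

include hs hj ht hr in
theorem linear_le_stabilizer (p : NewPoint) :
    P.linear ≤ (MulAction.stabilizer _ (Sum.inr p : Point24)).comap φ := by
  apply P.linear_le_of_mem <;>
    rw [Subgroup.mem_comap, MulAction.mem_stabilizer_iff, Equiv.Perm.smul_def]
  · rw [hs, slHom_new]
  · rw [hj, slHom_new]
  · rw [ht, slHom_new]
  · rw [hr, slHom_new]

include hζ hs hj ht hr hu hv hw in
-- `deg23` fixes w while 𝔴 moves it, `deg22` fixes v while 𝔳 moves it, and `linear` fixes u while 𝔲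
-- moves it; so a kernel element drops through the three cells into `linear`.
theorem eq_one_of_mem_deg24 {x : G} (hx : x ∈ P.deg24) (h1 : φ x = 1) : x = 1 := by
  refine eq_one_of_mem_linear (P := P.toLinearTuple) hζ hs hj ht hr ?_ h1
  have hl := linear_le_stabilizer hs hj ht hr
  refine mem_of_map_eq_one φ (MulAction.stabilizer _ (Sum.inr NewPoint.u : Point24))
    (fun y hy => hl _ hy) ?_ (P.deg22_cells ?_) h1
  · rw [MulAction.mem_stabilizer_iff, Equiv.Perm.smul_def, hu, S3_u]
    exact Sum.inl_ne_inr
  have hl22 : ∀ p, S3 (Sum.inr p) = Sum.inr p →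
      P.deg22 ≤ (MulAction.stabilizer _ (Sum.inr p : Point24)).comap φ := fun p hp => by
    refine sup_le (hl p) ?_
    rw [Subgroup.zpowers_le, Subgroup.mem_comap, MulAction.mem_stabilizer_iff,
      Equiv.Perm.smul_def, hu, hp]
  refine mem_of_map_eq_one φ (MulAction.stabilizer _ (Sum.inr NewPoint.v : Point24))
    (fun y hy => hl22 _ S3_v hy) ?_ (P.deg23_cells ?_) h1
  · rw [MulAction.mem_stabilizer_iff, Equiv.Perm.smul_def, hv, S4_v]
    exact fun h => by cases h
  have hl23 : P.deg23 ≤ (MulAction.stabilizer _ (Sum.inr NewPoint.w : Point24)).comap φ := by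
    refine sup_le (hl22 _ S3_w) ?_
    rw [Subgroup.zpowers_le, Subgroup.mem_comap, MulAction.mem_stabilizer_iff,
      Equiv.Perm.smul_def, hv, S4_w]
  refine mem_of_map_eq_one φ (MulAction.stabilizer _ (Sum.inr NewPoint.w : Point24))
    (fun y hy => hl23 hy) ?_ (P.deg24_cells hx) h1
  rw [MulAction.mem_stabilizer_iff, Equiv.Perm.smul_def, hw, S5_w]
  exact fun h => by cases h

end Faithful

/-- The generators of the presented group. -/
def presentedTuple : MathieuTuple (PresentedGroup relsM24) := by
  have h1 : ∀ x ∈ relsPSL34, PresentedGroup.mk relsM24 x = 1 := fun x hx =>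
    PresentedGroup.one_of_mem (Or.inl (Or.inl (Or.inl hx)))
  have h2 : ∀ x ∈ relsU, PresentedGroup.mk relsM24 x = 1 := fun x hx =>
    PresentedGroup.one_of_mem (Or.inl (Or.inl (Or.inr hx)))
  have h3 : ∀ x ∈ relsV, PresentedGroup.mk relsM24 x = 1 := fun x hx =>
    PresentedGroup.one_of_mem (Or.inl (Or.inr hx))
  have h4 : ∀ x ∈ relsW, PresentedGroup.mk relsM24 x = 1 := fun x hx =>
    PresentedGroup.one_of_mem (Or.inr hx)
  simp only [relsPSL34, relsU, relsV, relsW, Set.forall_mem_insert, Set.mem_singleton_iff,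
    forall_eq, cj, map_mul, map_pow, map_inv, mul_inv_eq_one] at h1 h2 h3 h4
  exact
    { s := PresentedGroup.mk relsM24 s
      j := PresentedGroup.mk relsM24 j
      t := PresentedGroup.mk relsM24 t
      r := PresentedGroup.mk relsM24 r
      u := PresentedGroup.mk relsM24 u
      v := PresentedGroup.mk relsM24 v
      w := PresentedGroup.mk relsM24 w
      s_sq := h1.1, j_sq := h1.2.1, t_sq := h1.2.2.1, r_cube := h1.2.2.2.1, jr_sq := h1.2.2.2.2.1, tr_sq := h1.2.2.2.2.2.1, sr_cube := h1.2.2.2.2.2.2.1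
      js_cube := h1.2.2.2.2.2.2.2.1, tj_cube := h1.2.2.2.2.2.2.2.2.1, tstjs_cube := h1.2.2.2.2.2.2.2.2.2.1, long := h1.2.2.2.2.2.2.2.2.2.2
      u_sq := h2.1, us_sq := h2.2.1, uj_cube := h2.2.2.1, ru := h2.2.2.2.1, stu := h2.2.2.2.2.1, sjtu := h2.2.2.2.2.2
      v_sq := h3.1, vs_sq := h3.2.1, vu_cube := h3.2.2.1, vj_sq := h3.2.2.2.1, vr_sq := h3.2.2.2.2.1, stv := h3.2.2.2.2.2.1, sjtv := h3.2.2.2.2.2.2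
      w_sq := h4.1, wr_sq := h4.2.1, ws_sq := h4.2.2.1, wj_sq := h4.2.2.2.1, wu_sq := h4.2.2.2.2.1, wst_sq := h4.2.2.2.2.2.1
      wsjt_sq := h4.2.2.2.2.2.2.1, wv_cube := h4.2.2.2.2.2.2.2 }

theorem presentedTuple_deg24 : presentedTuple.deg24 = ⊤ := by
  let P := presentedTuple
  have l : P.linear ≤ P.deg24 :=
    P.linear_le_deg22.trans (P.deg22_le_deg23.trans P.deg23_le_deg24)
  rw [eq_top_iff, ← PresentedGroup.closure_range_of, Subgroup.closure_le]
  rintro _ ⟨g, rfl⟩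
  cases g
  · exact l P.s_mem_linear
  · exact l P.j_mem_linear
  · exact l P.t_mem_linear
  · exact l P.r_mem_linear
  · exact P.deg23_le_deg24 (P.deg22_le_deg23 P.u_mem_deg22)
  · exact P.deg23_le_deg24 P.v_mem_deg23
  · exact P.w_mem_deg24

theorem closure_genPerm {ζ : F4ˣ} (hζ : ∀ x : F4ˣ, x ∈ Subgroup.zpowers ζ) :
    Subgroup.closure (Set.range (genPerm ζ)) = M24 ζ := by
  set N := Subgroup.closure (Set.range (genPerm ζ)) with hN
  have hgen : ∀ g, genPerm ζ g ∈ N := fun g => Subgroup.subset_closure ⟨g, rfl⟩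
  have h22 : M22 ≤ M23 ζ := fun x hx => Subgroup.subset_closure (Or.inl hx)
  have h23 : M23 ζ ≤ M24 ζ := fun x hx => Subgroup.subset_closure (Or.inl hx)
  have hlin : ∀ M, pslHom M ∈ M24 ζ := fun M =>
    h23 (h22 (Subgroup.subset_closure (Or.inl ⟨M, rfl⟩)))
  apply le_antisymm
  · rw [hN, Subgroup.closure_le]
    rintro _ ⟨g, rfl⟩
    cases g
    · exact hlin _
    · exact hlin _
    · exact hlin _
    · exact hlin _
    · exact h23 (h22 (Subgroup.subset_closure (Or.inr rfl)))
    · exact h23 (Subgroup.subset_closure (Or.inr rfl))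
    · exact Subgroup.subset_closure (Or.inr rfl)
  -- Mapping the presented tuple forward shows at once that the permutations form a `LinearTuple`,
  -- so the root elements are available in the closure.
  · let P := presentedTuple.toLinearTuple.map (PresentedGroup.toGroup (rels_genPerm hζ))
    have hP : ∀ g, PresentedGroup.toGroup (rels_genPerm hζ) (PresentedGroup.of g) = genPerm ζ g :=
      fun g => PresentedGroup.toGroup.of _
    have hmem : ∀ M, pslHom M ∈ N := by
      intro M
      obtain ⟨M, rfl⟩ := QuotientGroup.mk_surjective M
      refine slHom_mem (P := P) (ζ := ζ) (hP Gen.s) (hP Gen.j) (hP Gen.t) (hP Gen.r) hζ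
        ?_ ?_ ?_ ?_ M
      · exact (congrArg (· ∈ N) (hP Gen.s)).mpr (hgen Gen.s)
      · exact (congrArg (· ∈ N) (hP Gen.j)).mpr (hgen Gen.j)
      · exact (congrArg (· ∈ N) (hP Gen.t)).mpr (hgen Gen.t)
      · exact (congrArg (· ∈ N) (hP Gen.r)).mpr (hgen Gen.r)
    have n22 : M22 ≤ N := by
      rw [M22, Subgroup.closure_le]
      rintro x (⟨M, rfl⟩ | rfl)
      · exact hmem M
      · exact hgen Gen.u
    have n23 : M23 ζ ≤ N := by
      rw [M23, Subgroup.closure_le]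
      rintro x (hx | rfl)
      · exact n22 hx
      · exact hgen Gen.v
    rw [M24, Subgroup.closure_le]
    rintro x (hx | rfl)
    · exact n23 hx
    · exact hgen Gen.w

end Mathieu

end

/-- For every primitive element `ζ` of `GF(4)`, the permutations `𝔰, 𝔧, 𝔱, 𝔯, 𝔲, 𝔳, 𝔴` generate
`M₂₄`, and the listed relations are defining relations for these generators. -/
theorem proposition7p7 (ζ : Mathieu.F4ˣ) (hζ : ∀ x : Mathieu.F4ˣ, x ∈ Subgroup.zpowers ζ) :
    Subgroup.closure (Set.range (Mathieu.genPerm ζ)) = Mathieu.M24 ζ ∧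
      ∃ e : PresentedGroup Mathieu.relsM24 ≃* Mathieu.M24 ζ,
        ∀ g : Mathieu.Gen,
          ((e (PresentedGroup.of g) : Mathieu.M24 ζ) : Equiv.Perm Mathieu.Point24) =
            Mathieu.genPerm ζ g := by
  have hcl := Mathieu.closure_genPerm hζ
  refine ⟨hcl, ?_⟩
  let φ := PresentedGroup.toGroup (Mathieu.rels_genPerm hζ)
  have hφ : ∀ g, φ (PresentedGroup.of g) = Mathieu.genPerm ζ g :=
    fun g => PresentedGroup.toGroup.of _
  have hinj : Function.Injective φ := by
    rw [injective_iff_map_eq_one]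
    intro x hx
    exact Mathieu.eq_one_of_mem_deg24 (P := Mathieu.presentedTuple) hζ (hφ .s) (hφ .j) (hφ .t)
      (hφ .r) (hφ .u) (hφ .v) (hφ .w) (Mathieu.presentedTuple_deg24 ▸ Subgroup.mem_top x) hx
  have hrange : φ.range = Mathieu.M24 ζ := by
    rw [← hcl, MonoidHom.range_eq_map, ← PresentedGroup.closure_range_of, MonoidHom.map_closure,
      ← Set.range_comp]
    congr 2
  refine ⟨(MonoidHom.ofInjective hinj).trans (MulEquiv.subgroupCongr hrange), fun g => ?_⟩
  exact hφ g
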